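/- Let $\|\cdot\|$ be the Euclidean norm on $\mathbb R^2$. An asymmetric norm on $\mathbb R^2$ is a convex function $F:\mathbb R^2\to[0,\infty)$ with $F(u)=0$ only for $u=0$ and $F(\lambda u)=\lambda F(u)$ for all $\lambda\ge 0$; it is symmetric if $F(-u)=F(u)$ for all $u$. Its anisotropy ratio is $\kappa(F):=\max_{\|u\|=\|v\|=1}F(u)/F(v)$, and for $\theta\in\mathbb R$ we set $F^\theta(u):=F(R_\theta^{\mathsf T}u)$, where $R_\theta$ is the rotation matrix of angle $\theta$. Two non-zero vectors $u,v$ form an $F$-acute angle if $F(u+\delta v)\ge F(u)$ and $F(v+\delta u)\ge F(v)$ for all $\delta\ge 0$. The mesh $\mathcal T(F)$ is built by the following algorithm. Start from the lists $L=[(1,0)]$ and $M=[(1,0),(0,-1),(-1,0),(0,1)]$. While $M$ is non-empty, let $u$ and $v$ be the last elements of $L$ and $M$ respectively; if $u,v$ form an $F$-acute angle, remove $v$ from $M$ and append it to $L$; otherwise append $u+v$ to $M$. When $M$ is empty, $\mathcal T(F)$ is the set of the triangles with vertices $0,u,v$, where $u,v$ are consecutive elements of $L$, and $\#(\mathcal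 T(F))$ is the number of these triangles. Theorem. For every asymmetric norm $F$ on $\mathbb R^2$ and every $\theta \in \mathbb R$ the algorithm stops for $F^\theta$, and $\theta\mapsto\#(\mathcal T(F^\theta))$ is integrable on $[0,2\pi]$. Moreover there is an absolute constant $C$ such that for every asymmetric norm $F$ on $\mathbb R^2$ $$\int_0^{2\pi}\#(\mathcal T(F^\theta))\,d\theta\le C\,(1+(\ln\kappa(F))^3),$$ and, if $F$ is symmetric, $$\int_0^{2\pi}\#(\mathcal T(F^\theta))\,d\theta\le C\,(1+(\ln\kappa(F))^2).$$ -/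

import Mathlib

open MeasureTheory

/-- The Euclidean plane. -/
abbrev Plane : Type := EuclideanSpace ℝ (Fin 2)

/-- Asymmetric norms on the plane: proper (zero only at the origin), positively `1`-homogeneous,
convex functions with nonnegative values. -/
structure IsAsymNorm (F : Plane → ℝ) : Prop where
  nonneg : ∀ u, 0 ≤ F u
  eq_zero_iff : ∀ u, F u = 0 ↔ u = 0
  smul : ∀ (r : ℝ) (u : Plane), 0 ≤ r → F (r • u) = r * F u
  convex : ConvexOn ℝ Set.univ F

/-- The anisotropy ratio: the largest value of `F u / F v` over Euclidean unit vectors `u`, `v`. -/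
noncomputable def anisotropyRatio (F : Plane → ℝ) : ℝ :=
  sSup {r : ℝ | ∃ u v : Plane, ‖u‖ = 1 ∧ ‖v‖ = 1 ∧ r = F u / F v}

/-- The vectors `u`, `v` form an `F`-acute angle (used for nonzero vectors only). -/
def IsAcuteAngle (F : Plane → ℝ) (u v : Plane) : Prop :=
  ∀ δ : ℝ, 0 ≤ δ → F u ≤ F (u + δ • v) ∧ F v ≤ F (v + δ • u)

/-- The rotation matrix of angle `θ`. -/
noncomputable def rotationMatrix (θ : ℝ) : Matrix (Fin 2) (Fin 2) ℝ :=
  !![Real.cos θ, -Real.sin θ; Real.sin θ, Real.cos θ]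

/-- The rotated function, sending `u` to `F (R_θᵀ u)`. -/
noncomputable def rotated (F : Plane → ℝ) (θ : ℝ) : Plane → ℝ :=
  fun u => F (Matrix.toEuclideanLin (rotationMatrix θ).transpose u)

/-- A point of the lattice, seen as a vector of the plane. -/
noncomputable def latticeVec (z : ℤ × ℤ) : Plane := !₂[(z.1 : ℝ), (z.2 : ℝ)]

open Classical in
/-- One pass of the loop of the mesh construction, on the state `(L, M)`. Both lists are written
backwards: the head of a Lean list is the *last* element of the list of the algorithm. With `u`, `v`
the last elements of `L` and `M`: if they form an `F`-acute angle, then `v` is removed from `M` and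
appended to `L`; otherwise `u + v` is appended to `M`. Nothing happens once `M` is empty. -/
noncomputable def meshStep (F : Plane → ℝ) :
    List (ℤ × ℤ) × List (ℤ × ℤ) → List (ℤ × ℤ) × List (ℤ × ℤ)
  | (u :: L, v :: M) =>
    if IsAcuteAngle F (latticeVec u) (latticeVec v) then (v :: u :: L, M)
    else (u :: L, (u + v) :: v :: M)
  | s => s

/-- The state `(L, M)` after `n` passes, starting from `L = [(1,0)]` and
`M = [(1,0), (0,-1), (-1,0), (0,1)]` (last elements first, as in `meshStep`). -/
noncomputable def meshState (F : Plane → ℝ) (n : ℕ) : List (ℤ × ℤ) × List (ℤ × ℤ) :=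
  (meshStep F)^[n] ([(1, 0)], [(0, 1), (-1, 0), (0, -1), (1, 0)])

/-- The mesh construction stops (`M` becomes empty) with final list `L`, the (closed) list of
consecutive boundary vertices of the mesh. -/
def MeshStopsWith (F : Plane → ℝ) (L : List (ℤ × ℤ)) : Prop :=
  ∃ n, meshState F n = (L, [])

/-- The mesh `𝒯(F)`, as a set of triangles, each given by its set of vertices `{0, u, v}`, where
`u`, `v` are consecutive elements of the list produced by the mesh construction. -/
def acuteMesh (F : Plane → ℝ) : Set (Finset (ℤ × ℤ)) :=
  {T | ∃ L, MeshStopsWith F L ∧ ∃ u v, [u, v] <:+: L ∧ T = {0, u, v}}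

/-- The number of triangles of the mesh `𝒯(F)`. -/
noncomputable def meshCard (F : Plane → ℝ) : ℕ := (acuteMesh F).ncard

/-! Both estimates come from one bound, `integral_meshCard_rotated_le`: the integral is at most a
constant plus a constant times `(3 + log κ) * log κ`. For `L = log κ ≥ 0` this is dominated by `1 +
L ^ 2` and by `1 + L ^ 3`, up to constants.

Within a quadrant the algorithm explores a Stern–Brocot tree of direct lattice bases `(u, v)` with
nonnegative scalar product. Every refinement is caused by a basis that is not `F`-acute, and no
basis is visited twice, so the mesh size is controlled by the number of non-acute direct bases
(`exists_iterate_meshStep_eq`, `meshCard_le`).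

If `det (u, v) = 1` and `u · v = s`, then `v` is a positive multiple of `s • dir φ + dirPerp φ`,
with `φ` the angle of `u`. Failure of acuteness at `u` thus says that `φ` lies in `tiltSet F s`, a
condition on `φ` and `s` alone; failure at `v` is the mirror image (`mem_tiltSet_of_not_acute`). A
tilt satisfies `s < κ`, so finitely many bases matter and the algorithm stops. Rotating `F`
translates the tilt set, so averaging over `θ` replaces each basis by the measure of `tiltSet F s`
over a period.

The sum of these measures is the integral over `φ` of the number of bases whose scalar product is a
tilt at `φ`. Two facts bound it. There are `O((1 + K) log (K + 2))` direct bases with scalar product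
in `[0, K]` (`card_directPairs_le`). A tilt `s ≥ 1` at `φ` is less than minus the right logarithmic
derivative of `F (dir φ)` (`of_mem_tiltSet`, in a sector of width `π / 4`), so the largest tilt has
integral `O(log κ)` (`integral_le_of_tilt`). With `K = ⌊κ⌋₊`, one factor `log κ` comes from counting
and one from integration. -/

/-! ### Coordinates, asymmetric norms, rotations and a reflection. -/

/-- The point of the plane with coordinates `x` and `y`. -/
noncomputable def pt (x y : ℝ) : Plane := !₂[x, y]

@[simp] lemma pt_zero (x y : ℝ) : pt x y 0 = x := rfl

@[simp] lemma pt_one (x y : ℝ) : pt x y 1 = y := rfl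

lemma plane_ext {u v : Plane} (h0 : u 0 = v 0) (h1 : u 1 = v 1) : u = v := by
  ext i; fin_cases i <;> assumption

lemma pt_eta (u : Plane) : pt (u 0) (u 1) = u := plane_ext rfl rfl

lemma pt_add (a b c d : ℝ) : pt a b + pt c d = pt (a + c) (b + d) := plane_ext rfl rfl

lemma smul_pt (r a b : ℝ) : r • pt a b = pt (r * a) (r * b) := plane_ext rfl rfl

lemma norm_pt_sq (a b : ℝ) : ‖pt a b‖ ^ 2 = a ^ 2 + b ^ 2 := by
  rw [EuclideanSpace.norm_sq_eq]; simp

lemma continuous_pt {X : Type*} [TopologicalSpace X] {f g : X → ℝ} (hf : Continuous f)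
    (hg : Continuous g) : Continuous fun x => pt (f x) (g x) := by
  refine (PiLp.continuous_toLp 2 _).comp (continuous_pi fun i => ?_)
  fin_cases i
  · exact hf
  · exact hg

/-- The unit vector of angle `φ`. -/
noncomputable def dir (φ : ℝ) : Plane := pt (Real.cos φ) (Real.sin φ)

/-- The unit vector of angle `φ + π / 2`. -/
noncomputable def dirPerp (φ : ℝ) : Plane := pt (-Real.sin φ) (Real.cos φ)

lemma norm_dir (φ : ℝ) : ‖dir φ‖ = 1 := by
  have h : ‖dir φ‖ ^ 2 = 1 := by rw [dir, norm_pt_sq]; exact Real.cos_sq_add_sin_sq φ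
  nlinarith [norm_nonneg (dir φ)]

lemma norm_dirPerp (φ : ℝ) : ‖dirPerp φ‖ = 1 := by
  have h : ‖dirPerp φ‖ ^ 2 = 1 := by
    rw [dirPerp, norm_pt_sq, neg_sq]; exact Real.sin_sq_add_cos_sq φ
  nlinarith [norm_nonneg (dirPerp φ)]

lemma continuous_dir : Continuous dir := continuous_pt Real.continuous_cos Real.continuous_sin

lemma continuous_dirPerp : Continuous dirPerp :=
  continuous_pt Real.continuous_sin.neg Real.continuous_cos

namespace IsAsymNorm

variable {F : Plane → ℝ}

lemma pos (hF : IsAsymNorm F) {u : Plane} (hu : u ≠ 0) : 0 < F u :=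
  lt_of_le_of_ne (hF.nonneg u) fun h => hu ((hF.eq_zero_iff u).1 h.symm)

lemma pos_of_norm_eq_one (hF : IsAsymNorm F) {u : Plane} (hu : ‖u‖ = 1) : 0 < F u :=
  hF.pos fun h => by simp [h] at hu

lemma add_le (hF : IsAsymNorm F) (u v : Plane) : F (u + v) ≤ F u + F v := by
  have h := hF.convex.2 (Set.mem_univ ((2 : ℝ) • u)) (Set.mem_univ ((2 : ℝ) • v))
    (by norm_num : (0 : ℝ) ≤ 1 / 2) (by norm_num : (0 : ℝ) ≤ 1 / 2) (by norm_num)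
  rw [smul_smul, smul_smul, hF.smul 2 u (by norm_num), hF.smul 2 v (by norm_num)] at h
  norm_num at h
  linarith

lemma continuous (hF : IsAsymNorm F) : Continuous F :=
  continuousOn_univ.1 (hF.convex.continuousOn isOpen_univ)

lemma comp_linear (hF : IsAsymNorm F) (ℓ : Plane →ₗ[ℝ] Plane) (hℓ : Function.Injective ℓ) :
    IsAsymNorm fun u => F (ℓ u) where
  nonneg u := hF.nonneg _
  eq_zero_iff u := by rw [hF.eq_zero_iff, map_eq_zero_iff ℓ hℓ]
  smul r u hr := by rw [map_smul, hF.smul _ _ hr]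
  convex := hF.convex.comp_linearMap ℓ

lemma bddAbove_ratio (hF : IsAsymNorm F) :
    BddAbove {r : ℝ | ∃ u v : Plane, ‖u‖ = 1 ∧ ‖v‖ = 1 ∧ r = F u / F v} := by
  have hc : IsCompact (Metric.sphere (0 : Plane) 1) := isCompact_sphere _ _
  have hne : (Metric.sphere (0 : Plane) 1).Nonempty := ⟨dir 0, by simp [norm_dir]⟩
  obtain ⟨a, ha, hmax⟩ := hc.exists_isMaxOn hne hF.continuous.continuousOn
  obtain ⟨b, hb, hmin⟩ := hc.exists_isMinOn hne hF.continuous.continuousOn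
  refine ⟨F a / F b, ?_⟩
  rintro _ ⟨u, v, hu, hv, rfl⟩
  have h1 : F u ≤ F a := hmax (by simpa using hu)
  have h2 : F b ≤ F v := hmin (by simpa using hv)
  exact div_le_div₀ (hF.nonneg _) h1 (hF.pos_of_norm_eq_one (by simpa using hb)) h2

lemma le_anisotropyRatio_mul (hF : IsAsymNorm F) {u v : Plane} (hu : ‖u‖ = 1) (hv : ‖v‖ = 1) :
    F u ≤ anisotropyRatio F * F v := by
  rw [← div_le_iff₀ (hF.pos_of_norm_eq_one hv)]
  exact le_csSup hF.bddAbove_ratio ⟨u, v, hu, hv, rfl⟩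

lemma one_le_anisotropyRatio (hF : IsAsymNorm F) : 1 ≤ anisotropyRatio F := by
  have h := hF.le_anisotropyRatio_mul (norm_dir 0) (norm_dir 0)
  have := hF.pos_of_norm_eq_one (norm_dir 0)
  nlinarith

end IsAsymNorm

lemma transpose_rotationMatrix_pt (θ x y : ℝ) :
    Matrix.toEuclideanLin (rotationMatrix θ).transpose (pt x y) =
      pt (Real.cos θ * x + Real.sin θ * y) (-Real.sin θ * x + Real.cos θ * y) := by
  apply plane_ext <;>
    simp [Matrix.toLpLin_apply, rotationMatrix, pt]

lemma rotated_pt (F : Plane → ℝ) (θ x y : ℝ) : rotated F θ (pt x y) =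
    F (pt (Real.cos θ * x + Real.sin θ * y) (-Real.sin θ * x + Real.cos θ * y)) := by
  rw [rotated, transpose_rotationMatrix_pt]

lemma transpose_rotationMatrix_dir (θ φ : ℝ) :
    Matrix.toEuclideanLin (rotationMatrix θ).transpose (dir φ) = dir (φ - θ) := by
  rw [dir, transpose_rotationMatrix_pt, dir, Real.cos_sub, Real.sin_sub]
  congr 1 <;> ring

lemma transpose_rotationMatrix_dirPerp (θ φ : ℝ) :
    Matrix.toEuclideanLin (rotationMatrix θ).transpose (dirPerp φ) = dirPerp (φ - θ) := by
  rw [dirPerp, transpose_rotationMatrix_pt, dirPerp, Real.cos_sub, Real.sin_sub]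
  congr 1 <;> ring

lemma norm_transpose_rotationMatrix (θ : ℝ) (u : Plane) :
    ‖Matrix.toEuclideanLin (rotationMatrix θ).transpose u‖ = ‖u‖ := by
  rw [← sq_eq_sq₀ (norm_nonneg _) (norm_nonneg _), ← pt_eta u, transpose_rotationMatrix_pt,
    norm_pt_sq, norm_pt_sq]
  linear_combination (u 0 ^ 2 + u 1 ^ 2) * Real.cos_sq_add_sin_sq θ

namespace IsAsymNorm

variable {F : Plane → ℝ}

lemma rotated (hF : IsAsymNorm F) (θ : ℝ) : IsAsymNorm (rotated F θ) :=
  hF.comp_linear _ <| (injective_iff_map_eq_zero _).2 fun u hu => by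
    rw [← norm_eq_zero, ← norm_transpose_rotationMatrix θ u, hu, norm_zero]

end IsAsymNorm

/-- The reflection of the plane across the horizontal axis. -/
noncomputable def reflection : Plane →ₗ[ℝ] Plane where
  toFun u := pt (u 0) (-u 1)
  map_add' u v := by apply plane_ext <;> simp; ring
  map_smul' r u := by apply plane_ext <;> simp

lemma reflection_pt (x y : ℝ) : reflection (pt x y) = pt x (-y) := rfl

lemma norm_reflection (u : Plane) : ‖reflection u‖ = ‖u‖ := by
  rw [← sq_eq_sq₀ (norm_nonneg _) (norm_nonneg _), ← pt_eta u, reflection_pt,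
    norm_pt_sq, norm_pt_sq, neg_sq]

lemma IsAsymNorm.reflected {F : Plane → ℝ} (hF : IsAsymNorm F) :
    IsAsymNorm fun u => F (reflection u) :=
  hF.comp_linear _ <| (injective_iff_map_eq_zero _).2 fun u hu => by
    rw [← norm_eq_zero, ← norm_reflection, hu, norm_zero]

/-- `F u ≤ κ * F v` for all Euclidean unit vectors `u` and `v`. -/
def RatioLe (F : Plane → ℝ) (κ : ℝ) : Prop :=
  ∀ u v : Plane, ‖u‖ = 1 → ‖v‖ = 1 → F u ≤ κ * F v

lemma IsAsymNorm.ratioLe {F : Plane → ℝ} (hF : IsAsymNorm F) : RatioLe F (anisotropyRatio F) :=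
  fun _ _ => hF.le_anisotropyRatio_mul

lemma RatioLe.rotated {F : Plane → ℝ} {κ : ℝ} (h : RatioLe F κ) (θ : ℝ) :
    RatioLe (rotated F θ) κ := fun u v hu hv =>
  h _ _ (by rwa [norm_transpose_rotationMatrix]) (by rwa [norm_transpose_rotationMatrix])

lemma RatioLe.reflected {F : Plane → ℝ} {κ : ℝ} (h : RatioLe F κ) :
    RatioLe (fun u => F (reflection u)) κ := fun u v hu hv =>
  h _ _ (by rwa [norm_reflection]) (by rwa [norm_reflection])

/-! ### Tilt sets. -/

/-- The angles `φ` such that `F` decreases from `dir φ` in the direction of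
`s • dir φ + dirPerp φ`. -/
def tiltSet (F : Plane → ℝ) (s : ℝ) : Set ℝ :=
  {φ | ∃ δ : ℝ, 0 ≤ δ ∧ F (dir φ + δ • (s • dir φ + dirPerp φ)) < F (dir φ)}

lemma isOpen_tiltSet {F : Plane → ℝ} (hF : IsAsymNorm F) (s : ℝ) : IsOpen (tiltSet F s) := by
  have : tiltSet F s = ⋃ δ ∈ Set.Ici (0 : ℝ),
      {φ | F (dir φ + δ • (s • dir φ + dirPerp φ)) < F (dir φ)} := by
    ext φ; simp [tiltSet]
  rw [this]
  refine isOpen_biUnion fun δ _ => isOpen_lt ?_ (hF.continuous.comp continuous_dir)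
  exact hF.continuous.comp (continuous_dir.add
    (((continuous_dir.const_smul s).add continuous_dirPerp).const_smul δ))

lemma mem_tiltSet_add_two_pi (F : Plane → ℝ) (s φ : ℝ) :
    φ + 2 * Real.pi ∈ tiltSet F s ↔ φ ∈ tiltSet F s := by
  simp [tiltSet, dir, dirPerp]

lemma mem_tiltSet_rotated (F : Plane → ℝ) (s θ φ : ℝ) :
    φ ∈ tiltSet (rotated F θ) s ↔ φ - θ ∈ tiltSet F s := by
  simp only [tiltSet, rotated, Set.mem_ofPred_eq, map_add, map_smul, transpose_rotationMatrix_dir,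
    transpose_rotationMatrix_dirPerp]

lemma mem_tiltSet_reflected (F : Plane → ℝ) (s φ : ℝ) :
    φ ∈ tiltSet (fun u => F (reflection u)) s ↔
      ∃ δ : ℝ, 0 ≤ δ ∧ F (dir (-φ) + δ • (s • dir (-φ) - dirPerp (-φ))) < F (dir (-φ)) := by
  have h1 : reflection (dir φ) = dir (-φ) := by simp [dir, reflection_pt]
  have h2 : reflection (dirPerp φ) = -dirPerp (-φ) := by
    rw [dirPerp, dirPerp, reflection_pt, ← neg_one_smul ℝ (pt _ _), smul_pt]; simp
  simp only [tiltSet, Set.mem_ofPred_eq, map_add, map_smul, h1, h2, sub_eq_add_neg]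

/-- Adding `δ • -dirPerp φ` to the displaced point gives `(1 + δ * s) • dir φ`. By subadditivity the
gain `δ * s * F (dir φ)` is less than `δ * F (-dirPerp φ)`, which is at most `δ * κ * F (dir φ)`. -/
lemma lt_of_mem_tiltSet {F : Plane → ℝ} (hF : IsAsymNorm F) {κ : ℝ} (hκ : RatioLe F κ) {s φ : ℝ}
    (hs : 0 ≤ s) (h : φ ∈ tiltSet F s) : s < κ := by
  obtain ⟨δ, hδ, h⟩ := h
  have h1 := hF.add_le (dir φ + δ • (s • dir φ + dirPerp φ)) (δ • -dirPerp φ)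
  have e : dir φ + δ • (s • dir φ + dirPerp φ) + δ • -dirPerp φ = (1 + δ * s) • dir φ := by
    module
  rw [e, hF.smul _ _ (by positivity), hF.smul _ _ hδ] at h1
  have h2 := hκ (-dirPerp φ) (dir φ) (by rw [norm_neg, norm_dirPerp]) (norm_dir φ)
  have h3 := hF.pos_of_norm_eq_one (norm_dir φ)
  have h4 : δ * (s * F (dir φ)) < δ * (κ * F (dir φ)) := by nlinarith
  have h5 := lt_of_mul_lt_mul_left h4 hδ
  exact lt_of_mul_lt_mul_right h5 h3.le
-- Tilts and the logarithmic derivative of `F` along the unit circle.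
open Real Set in
lemma tan_le_one_of_le_pi_div_four {φ : ℝ} (h0 : 0 ≤ φ) (h1 : φ ≤ π / 4) : tan φ ≤ 1 := by
  rw [← tan_pi_div_four]
  exact strictMonoOn_tan.monotoneOn ⟨by linarith [pi_pos], by linarith [pi_pos]⟩
    ⟨by linarith [pi_pos], by linarith [pi_pos]⟩ h1

/-- The restriction of `F` to the vertical line of abscissa `1`. -/
noncomputable def verticalSection (F : Plane → ℝ) (t : ℝ) : ℝ := F (pt 1 t)

/-- The right derivative of `verticalSection F`. -/
noncomputable def verticalSlope (F : Plane → ℝ) (t : ℝ) : ℝ :=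
  derivWithin (verticalSection F) (Set.Ioi t) t

namespace IsAsymNorm

open Real Set

variable {F : Plane → ℝ}

lemma convexOn_verticalSection (hF : IsAsymNorm F) :
    ConvexOn ℝ univ (verticalSection F) := by
  refine ⟨convex_univ, fun x _ y _ a b ha hb hab => ?_⟩
  have h := hF.convex.2 (mem_univ (pt 1 x)) (mem_univ (pt 1 y)) ha hb hab
  have e : a • pt 1 x + b • pt 1 y = pt 1 (a • x + b • y) := by
    rw [smul_pt, smul_pt, pt_add]; simp [hab]
  rwa [e] at h

lemma verticalSection_pos (hF : IsAsymNorm F) (t : ℝ) : 0 < verticalSection F t :=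
  hF.pos fun h => by simpa using congrArg (fun u : Plane => u 0) h

lemma hasDerivWithinAt_verticalSection (hF : IsAsymNorm F) (t : ℝ) :
    HasDerivWithinAt (verticalSection F) (verticalSlope F t) (Ioi t) t :=
  hF.convexOn_verticalSection.hasDerivWithinAt_rightDeriv_of_mem_interior (by simp)

lemma monotone_verticalSlope (hF : IsAsymNorm F) : Monotone (verticalSlope F) := by
  have h := hF.convexOn_verticalSection.monotoneOn_rightDeriv
  rw [interior_univ] at h
  exact monotoneOn_univ.1 h

lemma add_verticalSlope_mul_le (hF : IsAsymNorm F) {t y : ℝ} (h : t ≤ y) :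
    verticalSection F t + verticalSlope F t * (y - t) ≤ verticalSection F y := by
  rcases h.eq_or_lt with rfl | h
  · simp
  have h1 := hF.convexOn_verticalSection.rightDeriv_le_slope_of_mem_interior (x := t) (y := y)
    (by simp) (mem_univ _) h
  rw [slope_def_field, le_div_iff₀ (by linarith)] at h1
  unfold verticalSlope
  linarith

lemma apply_dir (hF : IsAsymNorm F) {φ : ℝ} (h : 0 < cos φ) :
    F (dir φ) = cos φ * verticalSection F (tan φ) := by
  rw [verticalSection, ← hF.smul _ _ h.le, smul_pt, mul_one, mul_comm, tan_mul_cos h.ne', dir]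

lemma hasDerivWithinAt_log_dir (hF : IsAsymNorm F) {φ : ℝ} (h0 : -(π / 2) < φ) (h1 : φ < π / 2) :
    HasDerivWithinAt (fun x => log (F (dir x)))
      ((-sin φ * verticalSection F (tan φ) + verticalSlope F (tan φ) / cos φ) / F (dir φ))
      (Ioi φ) φ := by
  have hc : 0 < cos φ := cos_pos_of_mem_Ioo ⟨h0, h1⟩
  have htan : HasDerivWithinAt tan (1 / cos φ ^ 2) (Ioo φ (π / 2)) φ :=
    (hasDerivAt_tan hc.ne').hasDerivWithinAt
  -- The one-sided chain rule applies because `tan` is increasing: it sends the right of `φ` to the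
  -- right of `tan φ`.
  have hmaps : MapsTo tan (Ioo φ (π / 2)) (Ioi (tan φ)) := fun x hx =>
    strictMonoOn_tan ⟨h0, h1⟩ ⟨h0.trans hx.1, hx.2⟩ hx.1
  have hk := (hF.hasDerivWithinAt_verticalSection (tan φ)).comp φ htan hmaps
  have hprod := (hasDerivAt_cos φ).hasDerivWithinAt.mul hk
  have hfun : HasDerivWithinAt (fun x => F (dir x))
      (-sin φ * verticalSection F (tan φ) + verticalSlope F (tan φ) / cos φ)
      (Ioo φ (π / 2)) φ := by
    refine (hprod.congr (fun x hx => ?_) ?_).congr_deriv ?_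
    · exact hF.apply_dir (cos_pos_of_mem_Ioo ⟨h0.trans hx.1, hx.2⟩)
    · exact hF.apply_dir hc
    · simp only [Function.comp]; field_simp
  exact (hfun.log (hF.pos_of_norm_eq_one (norm_dir φ)).ne').mono_of_mem_nhdsWithin
    (Ioo_mem_nhdsGT h1)

/-- Projecting the displaced point radially to the line of abscissa `1` and using the tangent
inequality of the convex section `k` there gives `(s - t) * k t + k' t * (1 + t ^ 2) < 0` with `t =
tan φ`. Since `t ≤ 1 ≤ s`, the slope is negative; multiplying by `cos φ` gives the second claim,
whose right side is minus the numerator in `hasDerivWithinAt_log_dir`. -/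
lemma of_mem_tiltSet (hF : IsAsymNorm F) {φ s : ℝ} (h0 : 0 ≤ φ) (h1 : φ ≤ π / 4) (hs : 1 ≤ s)
    (h : φ ∈ tiltSet F s) :
    verticalSlope F (tan φ) < 0 ∧
      s * F (dir φ) <
        -(-sin φ * verticalSection F (tan φ) + verticalSlope F (tan φ) / cos φ) := by
  have hc : 0 < cos φ := cos_pos_of_mem_Ioo ⟨by linarith [pi_pos], by linarith [pi_pos]⟩
  have ht := tan_le_one_of_le_pi_div_four h0 h1
  have hsin : sin φ = tan φ * cos φ := (tan_mul_cos hc.ne').symm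
  have happ := hF.apply_dir hc
  have hk := hF.verticalSection_pos (tan φ)
  obtain ⟨δ, hδ, h⟩ := h
  set t := tan φ
  have hD : 0 < 1 + δ * (s - t) := by nlinarith
  have e : dir φ + δ • (s • dir φ + dirPerp φ) =
      (cos φ * (1 + δ * (s - t))) • pt 1 (t + δ * (1 + t ^ 2) / (1 + δ * (s - t))) := by
    apply plane_ext
    · simp [dir, dirPerp, hsin]; ring
    · simp [dir, dirPerp, hsin]; field_simp; ring
  have hl := hF.add_verticalSlope_mul_le (t := t)
    (y := t + δ * (1 + t ^ 2) / (1 + δ * (s - t)))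
    (le_add_of_nonneg_right (by positivity))
  rw [e, hF.smul _ _ (by positivity), happ, mul_assoc] at h
  change _ * (_ * verticalSection F _) < _ at h
  have h2 := lt_of_mul_lt_mul_left h hc.le
  have h3 := mul_le_mul_of_nonneg_left hl hD.le
  have e2 : (1 + δ * (s - t)) * (verticalSection F t + verticalSlope F t *
      (t + δ * (1 + t ^ 2) / (1 + δ * (s - t)) - t)) =
      (1 + δ * (s - t)) * verticalSection F t + verticalSlope F t * (δ * (1 + t ^ 2)) := by
    field_simp; ring
  rw [e2] at h3
  have h4 : δ * ((s - t) * verticalSection F t + verticalSlope F t * (1 + t ^ 2)) < δ * 0 := by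
    nlinarith
  have h5 := lt_of_mul_lt_mul_left h4 hδ
  have h6 : 0 ≤ (s - t) * verticalSection F t := mul_nonneg (by linarith) hk.le
  refine ⟨by nlinarith [sq_nonneg t], ?_⟩
  have h7 : verticalSlope F t / cos φ = cos φ * (verticalSlope F t * (1 + t ^ 2)) := by
    have : 1 + t ^ 2 = (cos φ ^ 2)⁻¹ := (inv_one_add_tan_sq hc.ne' ▸ (inv_inv _).symm :)
    rw [this]; field_simp
  rw [h7, happ, hsin]
  nlinarith

/-- On an angular sector of width `π / 4`, a function bounded by `c` times the largest tilt
has integral at most `c * log κ`. -/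
lemma integral_le_of_tilt (hF : IsAsymNorm F) {κ c : ℝ} (hκ : RatioLe F κ) (h1κ : 1 ≤ κ)
    (hc : 0 ≤ c) {ψ : ℝ → ℝ} (hint : IntegrableOn ψ (Icc 0 (π / 4)))
    (hψ : ∀ φ m : ℝ, 0 ≤ m → (∀ s : ℕ, 1 ≤ s → φ ∈ tiltSet F s → (s : ℝ) ≤ m) → ψ φ ≤ c * m) :
    ∫ φ in (0 : ℝ)..(π / 4), ψ φ ≤ c * log κ := by
  have hpi := pi_pos
  -- The angle `0` is adjoined so that the supremum `b` exists even when the sector contains no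
  -- tilt.
  set E : Set ℝ := {φ | φ ∈ Icc 0 (π / 4) ∧ (φ = 0 ∨ ∃ s : ℕ, 1 ≤ s ∧ φ ∈ tiltSet F s)}
  have h0E : (0 : ℝ) ∈ E := ⟨⟨le_rfl, by positivity⟩, Or.inl rfl⟩
  have hbdd : BddAbove E := ⟨π / 4, fun x hx => hx.1.2⟩
  set b := sSup E
  have hb0 : 0 ≤ b := le_csSup hbdd h0E
  have hb1 : b ≤ π / 4 := csSup_le ⟨0, h0E⟩ fun x hx => hx.1.2
  have hint1 : IntegrableOn ψ (Icc 0 b) := hint.mono_set (Icc_subset_Icc_right hb1)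
  have hint2 : IntegrableOn ψ (Icc b (π / 4)) := hint.mono_set (Icc_subset_Icc_left hb0)
  have hpos : ∀ x, 0 < F (dir x) := fun x => hF.pos_of_norm_eq_one (norm_dir x)
  have hleft : ∫ φ in (0 : ℝ)..b, ψ φ ≤ -(c * log (F (dir b))) - -(c * log (F (dir 0))) := by
    refine intervalIntegral.integral_le_sub_of_hasDeriv_right_of_le
      (g := fun x => -(c * log (F (dir x)))) hb0 ?_ (fun x hx =>
      ((hF.hasDerivWithinAt_log_dir (by linarith [hx.1]) (by linarith [hx.2])).const_mul c).neg)
      hint1 fun x hx => ?_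
    · exact (continuous_const.mul
        ((hF.continuous.comp continuous_dir).log fun x => (hpos x).ne')).neg.continuousOn
    · obtain ⟨y, ⟨hyI, hy⟩, hxy⟩ := exists_lt_of_lt_csSup ⟨0, h0E⟩ hx.2
      have hcx : 0 < cos x := cos_pos_of_mem_Ioo ⟨by linarith [hx.1], by linarith [hx.2]⟩
      obtain ⟨s, hs, hys⟩ := hy.resolve_left (by linarith [hx.1])
      -- Convexity: the slope is negative at a later tilted angle `y`, hence already at `x`. So
      -- minus the logarithmic derivative is nonnegative on all of `(0, b)`, even at untilted
      -- angles, and can serve as `m`.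
      have hslope : verticalSlope F (tan x) < 0 :=
        (hF.monotone_verticalSlope (strictMonoOn_tan ⟨by linarith [hx.1], by linarith [hx.2]⟩
          ⟨by linarith [hx.1], by linarith [hyI.2]⟩ hxy).le).trans_lt
          (hF.of_mem_tiltSet hyI.1 hyI.2 (by exact_mod_cast hs) hys).1
      have hsin : 0 ≤ sin x := sin_nonneg_of_nonneg_of_le_pi hx.1.le (by linarith [hx.2])
      have hk := hF.verticalSection_pos (tan x)
      rw [← mul_neg, ← neg_div]
      refine hψ x _ (div_nonneg ?_ (hpos x).le) fun s' hs' hx' => ?_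
      · have := div_nonpos_of_nonpos_of_nonneg hslope.le hcx.le
        nlinarith
      · rw [le_div_iff₀ (hpos x)]
        exact (hF.of_mem_tiltSet hx.1.le (by linarith [hx.2]) (by exact_mod_cast hs') hx').2.le
  -- Beyond `b` there is no tilt, so `m = 0` is admissible.
  have hright : ∫ φ in b..(π / 4), ψ φ ≤ ∫ φ in b..(π / 4), (0 : ℝ) := by
    refine intervalIntegral.integral_mono_on_of_le_Ioo hb1
      ((intervalIntegrable_iff_integrableOn_Icc_of_le hb1).2 hint2) intervalIntegrable_const
      fun x hx => ?_
    have := hψ x 0 le_rfl fun s hs hxs => absurd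
      (le_csSup hbdd ⟨⟨hb0.trans hx.1.le, hx.2.le⟩, Or.inr ⟨s, hs, hxs⟩⟩) (not_le.2 hx.1)
    simpa using this
  rw [← intervalIntegral.integral_add_adjacent_intervals
    ((intervalIntegrable_iff_integrableOn_Icc_of_le hb0).2 hint1)
    ((intervalIntegrable_iff_integrableOn_Icc_of_le hb1).2 hint2)]
  have hlog : log (F (dir 0)) ≤ log κ + log (F (dir b)) := by
    rw [← log_mul (by linarith) (hpos b).ne']
    exact log_le_log (hpos 0) (hκ _ _ (norm_dir 0) (norm_dir b))
  have := mul_le_mul_of_nonneg_left hlog hc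
  simp only [intervalIntegral.integral_zero] at hright
  linarith

/-- The version of `integral_le_of_tilt` over a whole period. -/
lemma integral_two_pi_le_of_tilt (hF : IsAsymNorm F) {κ c : ℝ} (hκ : RatioLe F κ) (h1κ : 1 ≤ κ)
    (hc : 0 ≤ c) {ψ : ℝ → ℝ} (hint : LocallyIntegrable ψ)
    (hψ : ∀ φ m : ℝ, 0 ≤ m → (∀ s : ℕ, 1 ≤ s → φ ∈ tiltSet F s → (s : ℝ) ≤ m) → ψ φ ≤ c * m) :
    ∫ φ in (0 : ℝ)..(2 * π), ψ φ ≤ 8 * (c * log κ) := by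
  have hsector : ∀ a : ℝ, ∫ φ in a..(a + π / 4), ψ φ ≤ c * log κ := fun a => by
    have h := (hF.rotated (-a)).integral_le_of_tilt (hκ.rotated (-a)) h1κ hc
      (ψ := fun φ => ψ (φ + a)) ?_ fun φ m hm h => hψ _ m hm fun s hs hφ => h s hs ?_
    · rwa [intervalIntegral.integral_comp_add_right, zero_add, add_comm] at h
    · have := (hint.integrableOn_isCompact (isCompact_Icc (a := 0 + a) (b := π / 4 + a)))
      rw [← intervalIntegrable_iff_integrableOn_Icc_of_le (by linarith [pi_pos])] at this ⊢
      simpa using this.comp_add_right a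
    · rw [mem_tiltSet_rotated]
      simpa using hφ
  have hsum := intervalIntegral.sum_integral_adjacent_intervals (f := ψ) (μ := volume)
    (a := fun j : ℕ => j * (π / 4)) (n := 8) fun k _ =>
      (hint.integrableOn_isCompact isCompact_uIcc).intervalIntegrable
  have e : ((8 : ℕ) : ℝ) * (π / 4) = 2 * π := by push_cast; ring
  rw [e, Nat.cast_zero, zero_mul] at hsum
  rw [← hsum]
  calc _ ≤ ∑ _k ∈ Finset.range 8, c * log κ := Finset.sum_le_sum fun k _ => by
        have := hsector (k * (π / 4))
        have e : ((k + 1 : ℕ) : ℝ) * (π / 4) = k * (π / 4) + π / 4 := by push_cast; ring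
        rwa [e]
    _ = 8 * (c * log κ) := by simp

end IsAsymNorm

/-! ### Counting direct lattice bases with bounded scalar product. -/

/-- The determinant of two lattice points. -/
def latticeDet (u v : ℤ × ℤ) : ℤ := u.1 * v.2 - u.2 * v.1

/-- The scalar product of two lattice points. -/
def latticeDot (u v : ℤ × ℤ) : ℤ := u.1 * v.1 + u.2 * v.2

/-- The lattice points with coordinates bounded by `K + 1`. -/
noncomputable def latticeBox (K : ℕ) : Finset (ℤ × ℤ) :=
  Finset.Icc (-(K + 1 : ℤ)) (K + 1) ×ˢ Finset.Icc (-(K + 1 : ℤ)) (K + 1)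

/-- The direct bases of the lattice whose scalar product lies between `0` and `K`. -/
noncomputable def directPairs (K : ℕ) : Finset ((ℤ × ℤ) × (ℤ × ℤ)) :=
  (latticeBox K ×ˢ latticeBox K).filter fun p =>
    latticeDet p.1 p.2 = 1 ∧ 0 ≤ latticeDot p.1 p.2 ∧ latticeDot p.1 p.2 ≤ K

lemma latticeDot_self_mul (u v : ℤ × ℤ) :
    latticeDot u u * latticeDot v v = latticeDot u v ^ 2 + latticeDet u v ^ 2 := by
  simp only [latticeDot, latticeDet]; ring

lemma latticeDot_self_nonneg (u : ℤ × ℤ) : 0 ≤ latticeDot u u :=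
  add_nonneg (mul_self_nonneg _) (mul_self_nonneg _)

lemma latticeDot_self_pos_of_det {u v : ℤ × ℤ} (h : latticeDet u v = 1) :
    0 < latticeDot u u ∧ 0 < latticeDot v v := by
  have h1 := latticeDot_self_mul u v
  have hu := latticeDot_self_nonneg u
  have hv := latticeDot_self_nonneg v
  constructor <;> by_contra! hn <;> nlinarith [sq_nonneg (latticeDot u v)]

lemma mem_latticeBox {K : ℕ} {u : ℤ × ℤ} (h : latticeDot u u ≤ (K + 1) ^ 2) :
    u ∈ latticeBox K := by
  simp only [latticeDot] at h
  simp only [latticeBox, Finset.mem_product, Finset.mem_Icc]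
  have h1 : |u.1| ≤ K + 1 := abs_le_of_sq_le_sq (by nlinarith [mul_self_nonneg u.2]) (by positivity)
  have h2 : |u.2| ≤ K + 1 := abs_le_of_sq_le_sq (by nlinarith [mul_self_nonneg u.1]) (by positivity)
  exact ⟨abs_le.1 h1, abs_le.1 h2⟩

lemma mem_directPairs {K : ℕ} {p : (ℤ × ℤ) × (ℤ × ℤ)} : p ∈ directPairs K ↔
    latticeDet p.1 p.2 = 1 ∧ 0 ≤ latticeDot p.1 p.2 ∧ latticeDot p.1 p.2 ≤ K := by
  refine ⟨fun h => (Finset.mem_filter.1 h).2, fun h => Finset.mem_filter.2 ⟨?_, h⟩⟩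
  obtain ⟨h1, h2, h3⟩ := h
  have hm := latticeDot_self_mul p.1 p.2
  obtain ⟨hu, hv⟩ := latticeDot_self_pos_of_det h1
  rw [h1] at hm
  have hs : latticeDot p.1 p.2 ^ 2 ≤ (K : ℤ) ^ 2 := pow_le_pow_left₀ h2 h3 2
  rw [Finset.mem_product]
  constructor <;> apply mem_latticeBox <;> nlinarith

/-- The pairs of `directPairs K` whose first vector is the shortest. -/
noncomputable def shortPairs (K : ℕ) : Finset ((ℤ × ℤ) × (ℤ × ℤ)) :=
  (directPairs K).filter fun p => latticeDot p.1 p.1 ≤ latticeDot p.2 p.2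

/-- Exchanging the two vectors reverses the orientation and exchanging the coordinates restores it;
doing both keeps the scalar product and makes the shorter vector the first. -/
lemma card_directPairs_le_two_mul (K : ℕ) : (directPairs K).card ≤ 2 * (shortPairs K).card := by
  have h := Finset.card_filter_add_card_filter_not
    (s := directPairs K) fun p => latticeDot p.1 p.1 ≤ latticeDot p.2 p.2
  have h2 : ((directPairs K).filter fun p => ¬ latticeDot p.1 p.1 ≤ latticeDot p.2 p.2).card ≤
      (shortPairs K).card := by
    refine Finset.card_le_card_of_injOn (fun p => (p.2.swap, p.1.swap)) (fun p hp => ?_) ?_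
    · simp only [Finset.coe_filter, mem_directPairs, Set.mem_ofPred_eq, not_le] at hp
      simp only [shortPairs, Finset.coe_filter, mem_directPairs, Set.mem_ofPred_eq]
      simp only [latticeDot, latticeDet, Prod.fst_swap, Prod.snd_swap] at hp ⊢
      obtain ⟨⟨h1, h2, h3⟩, h4⟩ := hp
      refine ⟨⟨?_, ?_, ?_⟩, ?_⟩ <;> linarith
    · rintro ⟨a, b⟩ _ ⟨c, d⟩ _ h
      simp only [Prod.mk.injEq, Prod.swap_inj] at h
      rw [h.1, h.2]
  unfold shortPairs at *
  omega

lemma eq_add_of_latticeDet {u v w : ℤ × ℤ} (hv : latticeDet u v = 1) (hw : latticeDet u w = 1) :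
    w = v + latticeDet w v • u := by
  simp only [latticeDet] at *
  ext
  · simp only [Prod.fst_add, Prod.smul_fst, smul_eq_mul]
    linear_combination v.1 * hw - w.1 * hv
  · simp only [Prod.snd_add, Prod.smul_snd, smul_eq_mul]
    linear_combination v.2 * hw - w.2 * hv

/-- For fixed `u`, the solutions `v` of `det (u, v) = 1` differ by multiples of `u`, which move `u ·
v` by multiples of `|u|²`; the quotient of `u · v` by `|u|²` therefore determines `v` and takes at
most `K / |u|² + 1` values. Lagrange's identity gives `|u|² ≤ K + 1` for the shorter vector, so this
count is at most `(2 * K + 1) / |u|²`. -/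
lemma card_shortPairs_le (K : ℕ) : ((shortPairs K).card : ℝ) ≤
    (2 * K + 1) * ∑ u ∈ latticeBox K with u ≠ 0, 1 / (latticeDot u u : ℝ) := by
  set B := (latticeBox K).filter fun u => u ≠ 0 ∧ latticeDot u u ≤ K + 1
  have hcard : (shortPairs K).card ≤
      (B.sigma fun u => Finset.range (K / (latticeDot u u).toNat + 1)).card := by
    refine Finset.card_le_card_of_injOn
      (fun p => ⟨p.1, (latticeDot p.1 p.2 / latticeDot p.1 p.1).toNat⟩) (fun p hp => ?_) ?_
    · simp only [shortPairs, Finset.coe_filter, mem_directPairs, Set.mem_ofPred_eq] at hp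
      obtain ⟨⟨h1, h2, h3⟩, h4⟩ := hp
      obtain ⟨hu, hv⟩ := latticeDot_self_pos_of_det h1
      have hm := latticeDot_self_mul p.1 p.2
      rw [h1] at hm
      have hn : latticeDot p.1 p.1 ≤ K + 1 := by nlinarith
      simp only [Finset.coe_sigma, Set.mem_sigma_iff, Finset.mem_coe, Finset.mem_range, B,
        Finset.mem_filter]
      refine ⟨⟨mem_latticeBox (by nlinarith), fun h0 => ?_, hn⟩, ?_⟩
      · rw [h0] at hu; simp [latticeDot] at hu
      · have h5 : latticeDot p.1 p.2 / latticeDot p.1 p.1 ≤ K / latticeDot p.1 p.1 :=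
          Int.ediv_le_ediv hu h3
        have h6 : ((K / (latticeDot p.1 p.1).toNat : ℕ) : ℤ) = K / latticeDot p.1 p.1 := by
          push_cast; rw [Int.toNat_of_nonneg hu.le]
        exact Nat.lt_succ_of_le (Int.toNat_le.2 (h5.trans_eq h6.symm))
    · rintro ⟨u, v⟩ hv ⟨u', w⟩ hw h
      simp only [Sigma.mk.injEq, heq_eq_eq] at h
      obtain ⟨rfl, h⟩ := h
      simp only [shortPairs, Finset.coe_filter, mem_directPairs, Set.mem_ofPred_eq] at hv hw
      obtain ⟨⟨hv1, hv2, -⟩, -⟩ := hv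
      obtain ⟨⟨hw1, hw2, -⟩, -⟩ := hw
      obtain ⟨hu, -⟩ := latticeDot_self_pos_of_det hv1
      have e := eq_add_of_latticeDet hv1 hw1
      set k := latticeDet w v
      have hdot : latticeDot u w = latticeDot u v + k * latticeDot u u := by
        rw [e]; simp only [latticeDot, Prod.fst_add, Prod.smul_fst, smul_eq_mul, Prod.snd_add,
          Prod.smul_snd]; ring
      have hdiv : latticeDot u w / latticeDot u u = latticeDot u v / latticeDot u u + k := by
        rw [hdot, Int.add_mul_ediv_right _ _ hu.ne']
      have hp1 := Int.ediv_nonneg hv2 hu.le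
      have hp2 := Int.ediv_nonneg hw2 hu.le
      have hk : k = 0 := by omega
      rw [hk, zero_smul, add_zero] at e
      rw [e]
  rw [Finset.card_sigma] at hcard
  calc ((shortPairs K).card : ℝ)
      ≤ ∑ u ∈ B, ((K / (latticeDot u u).toNat + 1 : ℕ) : ℝ) := by
        simp only [Finset.card_range] at hcard; exact_mod_cast hcard
    _ ≤ ∑ u ∈ B, (2 * K + 1) * (1 / (latticeDot u u : ℝ)) := by
        refine Finset.sum_le_sum fun u hu => ?_
        obtain ⟨-, hu0, hu1⟩ := Finset.mem_filter.1 hu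
        have hpos : 0 < latticeDot u u := by
          refine lt_of_le_of_ne (latticeDot_self_nonneg u) fun h => hu0 ?_
          simp only [latticeDot] at h
          ext
          · simp only [Prod.fst_zero]; nlinarith [mul_self_nonneg u.1, mul_self_nonneg u.2]
          · simp only [Prod.snd_zero]; nlinarith [mul_self_nonneg u.1, mul_self_nonneg u.2]
        have hposR : (0 : ℝ) < latticeDot u u := by exact_mod_cast hpos
        have hleR : (latticeDot u u : ℝ) ≤ K + 1 := by exact_mod_cast hu1
        have hcast : (((latticeDot u u).toNat : ℕ) : ℝ) = latticeDot u u := by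
          exact_mod_cast Int.toNat_of_nonneg hpos.le
        have h1 : ((K / (latticeDot u u).toNat : ℕ) : ℝ) ≤ K / latticeDot u u := by
          rw [← hcast]; exact Nat.cast_div_le
        rw [mul_one_div, le_div_iff₀ hposR]
        rw [le_div_iff₀ hposR] at h1
        push_cast at h1 ⊢
        nlinarith
    _ = (2 * K + 1) * ∑ u ∈ B, 1 / (latticeDot u u : ℝ) := by rw [Finset.mul_sum]
    _ ≤ _ := by
        refine mul_le_mul_of_nonneg_left ?_ (by positivity)
        refine Finset.sum_le_sum_of_subset_of_nonneg (fun u hu => ?_) fun u _ _ => ?_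
        · simp only [B, Finset.mem_filter] at hu ⊢; exact ⟨hu.1, hu.2.1⟩
        · exact one_div_nonneg.2 (by exact_mod_cast latticeDot_self_nonneg u)

lemma sum_Icc_natAbs_le (N : ℕ) {g : ℕ → ℝ} (hg : ∀ n, 0 ≤ g n) :
    ∑ a ∈ Finset.Icc (-(N : ℤ)) N, g a.natAbs ≤ 2 * ∑ a ∈ Finset.range (N + 1), g a := by
  have hsub : Finset.Icc (-(N : ℤ)) N ⊆ (Finset.range (N + 1)).image (fun n : ℕ => (n : ℤ)) ∪
      (Finset.range (N + 1)).image (fun n : ℕ => -(n : ℤ)) := by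
    intro a ha
    simp only [Finset.mem_Icc, Finset.mem_union, Finset.mem_image, Finset.mem_range] at *
    rcases le_total 0 a with h | h
    · exact Or.inl ⟨a.natAbs, by omega, by omega⟩
    · exact Or.inr ⟨a.natAbs, by omega, by omega⟩
  calc _ ≤ _ := Finset.sum_le_sum_of_subset_of_nonneg hsub fun _ _ _ => hg _
    _ ≤ _ := (le_add_of_nonneg_right (Finset.sum_nonneg fun _ _ => hg _)).trans_eq
      Finset.sum_union_inter
    _ = _ := by
      rw [Finset.sum_image fun _ _ _ _ h => by simpa using h,
        Finset.sum_image fun _ _ _ _ h => by simpa using h]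
      simp [two_mul]

lemma sum_one_div_sq_le (a N : ℕ) :
    ∑ b ∈ Finset.range (N + 1), 1 / ((a : ℝ) + b + 1) ^ 2 ≤ 2 / ((a : ℝ) + 1) := by
  -- The added term makes the induction telescope, through `1 / (m + 1) ^ 2 + 1 / (m + 1) ≤ 1 / m`.
  suffices h : ∑ b ∈ Finset.range (N + 1), 1 / ((a : ℝ) + b + 1) ^ 2 + 1 / (a + N + 1) ≤
      2 / ((a : ℝ) + 1) from le_trans (le_add_of_nonneg_right (by positivity)) h
  induction N with
  | zero =>
    simp only [zero_add, Finset.range_one, Finset.sum_singleton, Nat.cast_zero, add_zero]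
    rw [div_add_div _ _ (by positivity) (by positivity),
      div_le_div_iff₀ (by positivity) (by positivity)]
    have : (0 : ℝ) ≤ a := Nat.cast_nonneg a
    nlinarith [mul_nonneg this this, mul_nonneg this (mul_nonneg this this)]
  | succ N ih =>
    rw [Finset.sum_range_succ]
    refine le_trans ?_ ih
    have hm : (0 : ℝ) < a + N + 1 := by positivity
    have key : ∀ m : ℝ, 0 < m → 1 / (m + 1) ^ 2 + 1 / (m + 1) ≤ 1 / m := fun m hm => by
      rw [div_add_div _ _ (by positivity) (by positivity),
        div_le_div_iff₀ (by positivity) (by positivity)]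
      nlinarith [mul_pos hm hm]
    have := key _ hm
    push_cast
    rw [← add_assoc (a : ℝ)]
    linarith

lemma sum_one_div_latticeDot_le (K : ℕ) :
    ∑ u ∈ latticeBox K with u ≠ 0, 1 / (latticeDot u u : ℝ) ≤ 64 * (1 + Real.log (K + 2)) := by
  -- For `a + b ≥ 1`, `(a + b + 1) ^ 2 ≤ 4 * (a + b) ^ 2 ≤ 8 * (a ^ 2 + b ^ 2)`.
  set g : ℕ → ℕ → ℝ := fun a b => 8 * (1 / ((a : ℝ) + b + 1) ^ 2)
  have hg : ∀ a b, 0 ≤ g a b := fun a b => by positivity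
  calc ∑ u ∈ latticeBox K with u ≠ 0, 1 / (latticeDot u u : ℝ)
      ≤ ∑ u ∈ latticeBox K with u ≠ 0, g u.1.natAbs u.2.natAbs := by
        refine Finset.sum_le_sum fun u hu => ?_
        have hu0 := (Finset.mem_filter.1 hu).2
        have hne : 1 ≤ u.1.natAbs + u.2.natAbs := by
          by_contra! h
          exact hu0 (Prod.ext (by simp; omega) (by simp; omega))
        have e : (latticeDot u u : ℝ) = (u.1.natAbs : ℝ) ^ 2 + (u.2.natAbs : ℝ) ^ 2 := by
          rw [latticeDot, ← sq, ← sq, ← Int.natAbs_sq u.1, ← Int.natAbs_sq u.2]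
          push_cast; simp
        have hneR : (1 : ℝ) ≤ (u.1.natAbs : ℝ) + u.2.natAbs := by exact_mod_cast hne
        have hx : (0 : ℝ) ≤ u.1.natAbs := Nat.cast_nonneg _
        have hy : (0 : ℝ) ≤ u.2.natAbs := Nat.cast_nonneg _
        rw [e]
        simp only [g]
        rw [mul_one_div, div_le_div_iff₀ (by nlinarith [mul_nonneg hx hy]) (by positivity)]
        nlinarith [sq_nonneg ((u.1.natAbs : ℝ) - u.2.natAbs)]
    _ ≤ ∑ u ∈ latticeBox K, g u.1.natAbs u.2.natAbs :=
        Finset.sum_le_sum_of_subset_of_nonneg (Finset.filter_subset _ _) fun _ _ _ => hg _ _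
    _ = ∑ a ∈ Finset.Icc (-((K + 1 : ℕ) : ℤ)) (K + 1 : ℕ),
          ∑ b ∈ Finset.Icc (-((K + 1 : ℕ) : ℤ)) (K + 1 : ℕ), g a.natAbs b.natAbs := by
        rw [latticeBox, Finset.sum_product]; push_cast; rfl
    _ ≤ ∑ a ∈ Finset.Icc (-((K + 1 : ℕ) : ℤ)) (K + 1 : ℕ),
          2 * ∑ b ∈ Finset.range (K + 2), g a.natAbs b :=
        Finset.sum_le_sum fun a _ => sum_Icc_natAbs_le _ (hg _)
    _ ≤ 2 * ∑ a ∈ Finset.range (K + 2), 2 * ∑ b ∈ Finset.range (K + 2), g a b :=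
        sum_Icc_natAbs_le (K + 1) (g := fun a => 2 * ∑ b ∈ Finset.range (K + 2), g a b)
          fun a => mul_nonneg zero_le_two (Finset.sum_nonneg fun b _ => hg a b)
    _ ≤ 2 * ∑ a ∈ Finset.range (K + 2), 32 * (1 / ((a : ℝ) + 1)) := by
        refine mul_le_mul_of_nonneg_left (Finset.sum_le_sum fun a _ => ?_) zero_le_two
        have h := sum_one_div_sq_le a (K + 1)
        simp only [g]
        rw [← Finset.mul_sum]
        calc _ ≤ 2 * (8 * (2 / ((a : ℝ) + 1))) := by gcongr
          _ = _ := by ring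
    _ = 64 * (harmonic (K + 2) : ℝ) := by
        rw [← Finset.mul_sum, harmonic]; push_cast; simp only [one_div]; ring
    _ ≤ 64 * (1 + Real.log (K + 2)) := by
        have := harmonic_le_one_add_log (K + 2)
        push_cast at this
        linarith

lemma card_directPairs_le (K : ℕ) :
    ((directPairs K).card : ℝ) ≤ 128 * (2 * K + 1) * (1 + Real.log (K + 2)) := by
  have h1 : ((directPairs K).card : ℝ) ≤ 2 * (shortPairs K).card := by
    exact_mod_cast card_directPairs_le_two_mul K
  have h2 := card_shortPairs_le K
  have h3 := mul_le_mul_of_nonneg_left (sum_one_div_latticeDot_le K)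
    (by positivity : (0 : ℝ) ≤ 2 * K + 1)
  linarith

/-! ### The run of the algorithm and the size of the mesh. -/

lemma meshStep_of_acute {F : Plane → ℝ} {u v : ℤ × ℤ}
    (h : IsAcuteAngle F (latticeVec u) (latticeVec v)) (L M : List (ℤ × ℤ)) :
    meshStep F (u :: L, v :: M) = (v :: u :: L, M) := by
  simp [meshStep, h]

lemma meshStep_of_not_acute {F : Plane → ℝ} {u v : ℤ × ℤ}
    (h : ¬ IsAcuteAngle F (latticeVec u) (latticeVec v)) (L M : List (ℤ × ℤ)) :
    meshStep F (u :: L, v :: M) = (u :: L, (u + v) :: v :: M) := by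
  simp [meshStep, h]

lemma meshStep_nil (F : Plane → ℝ) (L : List (ℤ × ℤ)) : meshStep F (L, []) = (L, []) := by
  cases L <;> rfl

open Classical in
/-- The pairs of `directPairs K` which do not form an `F`-acute angle. -/
noncomputable def obtusePairs (F : Plane → ℝ) (K : ℕ) : Finset ((ℤ × ℤ) × (ℤ × ℤ)) :=
  (directPairs K).filter fun p => ¬ IsAcuteAngle F (latticeVec p.1) (latticeVec p.2)

lemma mem_obtusePairs {F : Plane → ℝ} {K : ℕ} {p : (ℤ × ℤ) × (ℤ × ℤ)} : p ∈ obtusePairs F K ↔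
    p ∈ directPairs K ∧ ¬ IsAcuteAngle F (latticeVec p.1) (latticeVec p.2) := by
  simp [obtusePairs]

/-- Direct bases with a scalar product larger than `K` form `F`-acute angles. -/
def AcuteBeyond (F : Plane → ℝ) (K : ℕ) : Prop :=
  ∀ u v : ℤ × ℤ, latticeDet u v = 1 → (K : ℤ) < latticeDot u v →
    IsAcuteAngle F (latticeVec u) (latticeVec v)

/-- Splitting `(u, v)` into `(u, u + v)` and `(u + v, v)` raises the scalar product by `|u|²` or
`|v|²`, hence by at least `1`, so `n` is enough fuel to pass `K`. The set `W` collects the bases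
that were split, one for each inserted vector of `l`; recording that they lie in the cone of `u` and
`v` is what shows that no basis is counted twice. -/
lemma exists_iterate_meshStep_eq {F : Plane → ℝ} {K : ℕ} (hK : AcuteBeyond F K) (n : ℕ)
    (u v : ℤ × ℤ) (hdet : latticeDet u v = 1) (hdot : 0 ≤ latticeDot u v)
    (hn : (K : ℤ) < latticeDot u v + n) :
    ∃ (m : ℕ) (l : List (ℤ × ℤ)) (W : Finset ((ℤ × ℤ) × (ℤ × ℤ))),
      (∀ L M, (meshStep F)^[m] (u :: L, v :: M) = (v :: (l ++ u :: L), M)) ∧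
      W ⊆ obtusePairs F K ∧ l.length ≤ W.card ∧
      ∀ p ∈ W, 0 ≤ latticeDet u p.1 ∧ 0 ≤ latticeDet u p.2 ∧
        0 ≤ latticeDet p.1 v ∧ 0 ≤ latticeDet p.2 v := by
  induction n generalizing u v with
  | zero =>
    have ha := hK u v hdet (by simpa using hn)
    exact ⟨1, [], ∅, fun L M => meshStep_of_acute ha L M, by simp, by simp, by simp⟩
  | succ n ih =>
    by_cases ha : IsAcuteAngle F (latticeVec u) (latticeVec v)
    · exact ⟨1, [], ∅, fun L M => meshStep_of_acute ha L M, by simp, by simp, by simp⟩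
    have huv : (u, v) ∈ obtusePairs F K := by
      refine mem_obtusePairs.2 ⟨mem_directPairs.2 ⟨hdet, hdot, ?_⟩, ha⟩
      by_contra! h
      exact ha (hK u v hdet h)
    obtain ⟨hu, hv⟩ := latticeDot_self_pos_of_det hdet
    have hadd1 : ∀ x y z, latticeDet x (y + z) = latticeDet x y + latticeDet x z := fun x y z => by
      simp only [latticeDet, Prod.fst_add, Prod.snd_add]; ring
    have hadd2 : ∀ x y z, latticeDet (x + y) z = latticeDet x z + latticeDet y z := fun x y z => by
      simp only [latticeDet, Prod.fst_add, Prod.snd_add]; ring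
    have hself : ∀ x, latticeDet x x = 0 := fun x => by simp only [latticeDet]; ring
    have hanti : ∀ x y, latticeDet x y = -latticeDet y x := fun x y => by
      simp only [latticeDet]; ring
    have hdot1 : latticeDot u (u + v) = latticeDot u u + latticeDot u v := by
      simp only [latticeDot, Prod.fst_add, Prod.snd_add]; ring
    have hdot2 : latticeDot (u + v) v = latticeDot u v + latticeDot v v := by
      simp only [latticeDot, Prod.fst_add, Prod.snd_add]; ring
    push_cast at hn
    obtain ⟨m₁, l₁, W₁, hm₁, hW₁, hl₁, hc₁⟩ := ih u (u + v)
      (by rw [hadd1, hself, hdet, zero_add]) (by omega) (by omega)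
    obtain ⟨m₂, l₂, W₂, hm₂, hW₂, hl₂, hc₂⟩ := ih (u + v) v
      (by rw [hadd2, hself, hdet, add_zero]) (by omega) (by omega)
    have hdetW : ∀ p ∈ obtusePairs F K, latticeDet p.1 p.2 = 1 := fun p hp =>
      (mem_directPairs.1 (mem_obtusePairs.1 hp).1).1
    -- The two subcones meet only along `u + v`, and two vectors parallel to `u + v` cannot have
    -- determinant `1`.
    have hdisj : Disjoint W₁ W₂ := Finset.disjoint_left.2 fun p hp₁ hp₂ => by
      have h := hdetW p (hW₁ hp₁)
      obtain ⟨-, -, h3, h4⟩ := hc₁ p hp₁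
      obtain ⟨h5, h6, -, -⟩ := hc₂ p hp₂
      rw [hanti] at h5 h6
      have z1 : latticeDet p.1 (u + v) = 0 := by omega
      have z2 : latticeDet p.2 (u + v) = 0 := by omega
      have hw1 : (u + v).1 = 0 := by
        simp only [latticeDet] at h z1 z2
        linear_combination p.2.1 * z1 - p.1.1 * z2 - (u + v).1 * h
      have hw2 : (u + v).2 = 0 := by
        simp only [latticeDet] at h z1 z2
        linear_combination p.2.2 * z1 - p.1.2 * z2 - (u + v).2 * h
      have h7 : latticeDet u (u + v) = 1 := by rw [hadd1, hself, hdet, zero_add]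
      rw [latticeDet, hw1, hw2] at h7
      omega
    -- The vector `v` is outside the first subcone and `u` is outside the second.
    have hnot : (u, v) ∉ W₁ ∪ W₂ := fun h => by
      rcases Finset.mem_union.1 h with h | h
      · obtain ⟨-, -, -, h⟩ := hc₁ _ h
        simp only [hadd1, hself] at h
        rw [hanti] at h
        omega
      · obtain ⟨h, -⟩ := hc₂ _ h
        simp only [hadd2, hself] at h
        rw [hanti] at h
        omega
    refine ⟨m₂ + (m₁ + 1), l₂ ++ (u + v) :: l₁, insert (u, v) (W₁ ∪ W₂), fun L M => ?_, ?_, ?_, ?_⟩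
    · rw [Function.iterate_add_apply, Function.iterate_succ_apply, meshStep_of_not_acute ha, hm₁,
        hm₂]
      simp
    · exact Finset.insert_subset huv (Finset.union_subset hW₁ hW₂)
    · rw [Finset.card_insert_of_notMem hnot, Finset.card_union_of_disjoint hdisj]
      simp only [List.length_append, List.length_cons]
      omega
    · intro p hp
      rcases Finset.mem_insert.1 hp with rfl | hp
      · simp only [hself, hdet]; omega
      rcases Finset.mem_union.1 hp with hp | hp
      · obtain ⟨h1, h2, h3, h4⟩ := hc₁ p hp
        rw [hadd1, hanti _ u] at h3 h4
        omega
      · obtain ⟨h1, h2, h3, h4⟩ := hc₂ p hp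
        rw [hadd2, hanti v] at h1 h2
        omega

lemma exists_meshStopsWith {F : Plane → ℝ} {K : ℕ} (hK : AcuteBeyond F K) :
    ∃ L, MeshStopsWith F L ∧ L.length ≤ 5 + 4 * (obtusePairs F K).card := by
  have key : ∀ u v : ℤ × ℤ, latticeDet u v = 1 → latticeDot u v = 0 →
      ∃ (m : ℕ) (l : List (ℤ × ℤ)), l.length ≤ (obtusePairs F K).card ∧
      ∀ L M, (meshStep F)^[m] (u :: L, v :: M) = (v :: (l ++ u :: L), M) := fun u v h1 h2 => by
    obtain ⟨m, l, W, hm, hW, hl, -⟩ :=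
      exists_iterate_meshStep_eq hK (K + 1) u v h1 h2.ge (by push_cast; omega)
    exact ⟨m, l, hl.trans (Finset.card_le_card hW), hm⟩
  obtain ⟨m₁, l₁, h₁, e₁⟩ := key (1, 0) (0, 1) rfl rfl
  obtain ⟨m₂, l₂, h₂, e₂⟩ := key (0, 1) (-1, 0) rfl rfl
  obtain ⟨m₃, l₃, h₃, e₃⟩ := key (-1, 0) (0, -1) rfl rfl
  obtain ⟨m₄, l₄, h₄, e₄⟩ := key (0, -1) (1, 0) rfl rfl
  refine ⟨(1, 0) :: (l₄ ++ (0, -1) :: (l₃ ++ (-1, 0) :: (l₂ ++ (0, 1) :: (l₁ ++ [(1, 0)])))),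
    ⟨m₄ + (m₃ + (m₂ + m₁)), ?_⟩, ?_⟩
  · rw [meshState, Function.iterate_add_apply, Function.iterate_add_apply,
      Function.iterate_add_apply, e₁, e₂, e₃, e₄]
  · simp only [List.length_append, List.length_cons, List.length_nil]
    omega

lemma MeshStopsWith.unique {F : Plane → ℝ} {L L' : List (ℤ × ℤ)} (h : MeshStopsWith F L)
    (h' : MeshStopsWith F L') : L = L' := by
  have stable : ∀ {n L}, meshState F n = (L, []) → ∀ k, meshState F (k + n) = (L, []) :=
    fun {n L} h k => by
      rw [meshState, Function.iterate_add_apply, ← meshState, h]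
      exact Function.iterate_fixed (meshStep_nil F L) k
  obtain ⟨n, hn⟩ := h
  obtain ⟨n', hn'⟩ := h'
  have h1 := stable hn n'
  rw [add_comm, stable hn' n] at h1
  exact (Prod.ext_iff.1 h1).1.symm

/-- The set of the triangles `{0, u, v}` where `u`, `v` are consecutive elements of `L`. -/
def fanOf (L : List (ℤ × ℤ)) : Set (Finset (ℤ × ℤ)) :=
  {T | ∃ u v, [u, v] <:+: L ∧ T = {0, u, v}}

lemma MeshStopsWith.meshCard_eq {F : Plane → ℝ} {L : List (ℤ × ℤ)} (h : MeshStopsWith F L) :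
    meshCard F = (fanOf L).ncard := by
  have : acuteMesh F = fanOf L := by
    ext T
    constructor
    · rintro ⟨L', h', hT⟩
      rwa [h.unique h']
    · exact fun hT => ⟨L, h, hT⟩
  rw [meshCard, this]

lemma ncard_fanOf_le (L : List (ℤ × ℤ)) : (fanOf L).ncard ≤ L.length := by
  have hsub : fanOf L ⊆ ((L.zip L.tail).toFinset.image
      fun p => ({0, p.1, p.2} : Finset (ℤ × ℤ)) : Finset (Finset (ℤ × ℤ))) := by
    rintro T ⟨u, v, ⟨s, t, rfl⟩, rfl⟩
    rw [Finset.coe_image]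
    refine ⟨(u, v), ?_, rfl⟩
    rw [List.coe_toFinset, Set.mem_ofPred_eq]
    cases s with
    | nil => simp
    | cons a s =>
      have e : ((a :: s ++ [u, v] ++ t).zip (a :: s ++ [u, v] ++ t).tail) =
          ((a :: s) ++ (u :: v :: t)).zip ((s ++ [u]) ++ (v :: t)) := by simp
      rw [e, List.zip_append (by simp)]
      simp
  refine (Set.ncard_le_ncard hsub (Finset.finite_toSet _)).trans ?_
  rw [Set.ncard_coe_finset]
  refine Finset.card_image_le.trans ((List.toFinset_card_le _).trans ?_)
  simp

lemma meshCard_le {F : Plane → ℝ} {K : ℕ} (hK : AcuteBeyond F K) :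
    meshCard F ≤ 5 + 4 * (obtusePairs F K).card := by
  obtain ⟨L, hL, hle⟩ := exists_meshStopsWith hK
  rw [hL.meshCard_eq]
  exact (ncard_fanOf_le L).trans hle

/-! ### From non-acute lattice bases to tilts. -/

/-- The polar angle of a vector of the plane. -/
noncomputable def polarAngle (w : Plane) : ℝ := Complex.arg ⟨w 0, w 1⟩

lemma norm_smul_dir_polarAngle (w : Plane) : ‖w‖ • dir (polarAngle w) = w := by
  have h : ‖w‖ = ‖(⟨w 0, w 1⟩ : ℂ)‖ := by
    rw [← sq_eq_sq₀ (norm_nonneg _) (norm_nonneg _), Complex.sq_norm, Complex.normSq_mk,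
      ← pt_eta w, norm_pt_sq]
    simp only [pt_zero, pt_one]; ring
  rw [h, dir, smul_pt, polarAngle, Complex.norm_mul_cos_arg, Complex.norm_mul_sin_arg]
  exact pt_eta w

lemma latticeVec_eq_pt (z : ℤ × ℤ) : latticeVec z = pt z.1 z.2 := rfl

lemma exists_polar (z : ℤ × ℤ) : ∃ r φ, φ = polarAngle (latticeVec z) ∧ 0 ≤ r ∧
    (z.1 : ℝ) = r * Real.cos φ ∧ (z.2 : ℝ) = r * Real.sin φ := by
  refine ⟨‖latticeVec z‖, _, rfl, norm_nonneg _, ?_, ?_⟩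
  · exact congrArg (fun w : Plane => w 0) (norm_smul_dir_polarAngle (latticeVec z)).symm
  · exact congrArg (fun w : Plane => w 1) (norm_smul_dir_polarAngle (latticeVec z)).symm

namespace IsAsymNorm

variable {F : Plane → ℝ}

/-- In the orthonormal frame of `u = r • dir φ`, the components of `v` are `(u · v) / r` and `det
(u, v) / r = 1 / r`. Dividing by `r` turns the step `δ` into `δ / r ^ 2`. -/
lemma mem_tiltSet_of_lt (hF : IsAsymNorm F) {u v : ℤ × ℤ} (hdet : latticeDet u v = 1) {δ : ℝ}
    (hδ : 0 ≤ δ) (h : F (latticeVec u + δ • latticeVec v) < F (latticeVec u)) :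
    polarAngle (latticeVec u) ∈ tiltSet F (latticeDot u v) := by
  obtain ⟨r, φ, hφ, hr, h1, h2⟩ := exists_polar u
  have hd : (u.1 : ℝ) * v.2 - u.2 * v.1 = 1 := by exact_mod_cast hdet
  have hr : 0 < r := hr.lt_of_ne fun h0 => by rw [h1, h2, ← h0] at hd; simp at hd
  have hs : (latticeDot u v : ℝ) = u.1 * v.1 + u.2 * v.2 := by rw [latticeDot]; push_cast; rfl
  have hsc := Real.sin_sq_add_cos_sq φ
  have hu : latticeVec u = r • dir φ := by rw [latticeVec_eq_pt, h1, h2, dir, smul_pt]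
  rw [h1, h2] at hd hs
  have hv : δ • latticeVec v = r • ((δ / r ^ 2) •
      ((latticeDot u v : ℝ) • dir φ + dirPerp φ)) := by
    rw [hs]
    apply plane_ext
    · simp [latticeVec_eq_pt, dir, dirPerp]
      field_simp
      linear_combination -Real.sin φ * hd * δ - δ * r * v.1 * hsc
    · simp [latticeVec_eq_pt, dir, dirPerp]
      field_simp
      linear_combination Real.cos φ * hd * δ - δ * r * v.2 * hsc
  rw [hv, hu, ← smul_add, hF.smul _ _ hr.le, hF.smul _ _ hr.le] at h
  rw [← hφ]
  exact ⟨δ / r ^ 2, by positivity, lt_of_mul_lt_mul_left h hr.le⟩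

lemma mem_tiltSet_reflected_of_lt (hF : IsAsymNorm F) {u v : ℤ × ℤ} (hdet : latticeDet u v = 1)
    {δ : ℝ} (hδ : 0 ≤ δ) (h : F (latticeVec v + δ • latticeVec u) < F (latticeVec v)) :
    -polarAngle (latticeVec v) ∈ tiltSet (fun w => F (reflection w)) (latticeDot u v) := by
  obtain ⟨r, φ, hφ, hr, h1, h2⟩ := exists_polar v
  have hd : (u.1 : ℝ) * v.2 - u.2 * v.1 = 1 := by exact_mod_cast hdet
  have hr : 0 < r := hr.lt_of_ne fun h0 => by rw [h1, h2, ← h0] at hd; simp at hd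
  have hs : (latticeDot u v : ℝ) = u.1 * v.1 + u.2 * v.2 := by rw [latticeDot]; push_cast; rfl
  have hsc := Real.sin_sq_add_cos_sq φ
  have hu : latticeVec v = r • dir φ := by rw [latticeVec_eq_pt, h1, h2, dir, smul_pt]
  rw [h1, h2] at hd hs
  have hv : δ • latticeVec u = r • ((δ / r ^ 2) •
      ((latticeDot u v : ℝ) • dir φ - dirPerp φ)) := by
    rw [hs]
    apply plane_ext
    · simp [latticeVec_eq_pt, dir, dirPerp]
      field_simp
      linear_combination Real.sin φ * hd * δ - δ * r * u.1 * hsc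
    · simp [latticeVec_eq_pt, dir, dirPerp]
      field_simp
      linear_combination -Real.cos φ * hd * δ - δ * r * u.2 * hsc
  rw [hv, hu, ← smul_add, hF.smul _ _ hr.le, hF.smul _ _ hr.le] at h
  rw [← hφ, mem_tiltSet_reflected, neg_neg]
  exact ⟨δ / r ^ 2, by positivity, lt_of_mul_lt_mul_left h hr.le⟩

lemma mem_tiltSet_of_not_acute (hF : IsAsymNorm F) {u v : ℤ × ℤ} (hdet : latticeDet u v = 1)
    (h : ¬ IsAcuteAngle F (latticeVec u) (latticeVec v)) :
    polarAngle (latticeVec u) ∈ tiltSet F (latticeDot u v) ∨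
      -polarAngle (latticeVec v) ∈ tiltSet (fun w => F (reflection w)) (latticeDot u v) := by
  simp only [IsAcuteAngle, not_forall, not_and_or, not_le] at h
  obtain ⟨δ, hδ, h | h⟩ := h
  · exact Or.inl (hF.mem_tiltSet_of_lt hdet hδ h)
  · exact Or.inr (hF.mem_tiltSet_reflected_of_lt hdet hδ h)

lemma acuteBeyond (hF : IsAsymNorm F) {κ : ℝ} (hκ : RatioLe F κ) {K : ℕ} (hK : κ ≤ K + 1) :
    AcuteBeyond F K := fun u v hdet hdot => by
  by_contra h
  have hs : ((K : ℝ) + 1) ≤ latticeDot u v := by exact_mod_cast hdot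
  have hs0 : (0 : ℝ) ≤ latticeDot u v := le_trans (by positivity) hs
  rcases hF.mem_tiltSet_of_not_acute hdet h with h | h
  · exact absurd (lt_of_mem_tiltSet hF hκ hs0 h) (by linarith)
  · exact absurd (lt_of_mem_tiltSet hF.reflected hκ.reflected hs0 h) (by linarith)

/-! ### Measurability and integrability in the angle of rotation. -/

lemma continuous_rotated_apply (hF : IsAsymNorm F) (w : Plane) :
    Continuous fun θ => _root_.rotated F θ w := by
  rw [← pt_eta w]
  simp only [rotated_pt]
  exact hF.continuous.comp (continuous_pt (by fun_prop) (by fun_prop))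

/-- The intersection over `δ` is uncountable, but each condition is closed in `θ`, so the set is
closed. -/
lemma measurableSet_acute (hF : IsAsymNorm F) (u v : Plane) :
    MeasurableSet {θ | IsAcuteAngle (_root_.rotated F θ) u v} := by
  have h : {θ | IsAcuteAngle (_root_.rotated F θ) u v} = ⋂ δ ∈ Set.Ici (0 : ℝ),
      ({θ | _root_.rotated F θ u ≤ _root_.rotated F θ (u + δ • v)} ∩
        {θ | _root_.rotated F θ v ≤ _root_.rotated F θ (v + δ • u)}) := by
    ext θ; simp [IsAcuteAngle]
  rw [h]
  exact (isClosed_biInter fun δ _ =>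
    (isClosed_le (hF.continuous_rotated_apply _) (hF.continuous_rotated_apply _)).inter
    (isClosed_le (hF.continuous_rotated_apply _) (hF.continuous_rotated_apply _))).measurableSet

lemma measurableSet_meshStep (hF : IsAsymNorm F) (s s' : List (ℤ × ℤ) × List (ℤ × ℤ)) :
    MeasurableSet {θ | meshStep (_root_.rotated F θ) s = s'} := by
  rcases s with ⟨_ | ⟨u, L⟩, _ | ⟨v, M⟩⟩
  · exact MeasurableSet.const (([], []) = s')
  · exact MeasurableSet.const (([], v :: M) = s')
  · exact MeasurableSet.const ((u :: L, []) = s')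
  have hA := hF.measurableSet_acute (latticeVec u) (latticeVec v)
  have h : {θ | meshStep (_root_.rotated F θ) (u :: L, v :: M) = s'} =
      ({θ | IsAcuteAngle (_root_.rotated F θ) (latticeVec u) (latticeVec v)} ∩
        {_θ : ℝ | (v :: u :: L, M) = s'}) ∪
      ({θ | IsAcuteAngle (_root_.rotated F θ) (latticeVec u) (latticeVec v)}ᶜ ∩
        {_θ : ℝ | (u :: L, (u + v) :: v :: M) = s'}) := by
    ext θ
    by_cases ha : IsAcuteAngle (_root_.rotated F θ) (latticeVec u) (latticeVec v)
    · simp [meshStep_of_acute ha, ha]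
    · simp [meshStep_of_not_acute ha, ha]
  rw [h]
  exact (hA.inter (.const _)).union (hA.compl.inter (.const _))

/-- There are countably many states, so one may take a union over the preceding one. -/
lemma measurableSet_meshState (hF : IsAsymNorm F) (n : ℕ) (s : List (ℤ × ℤ) × List (ℤ × ℤ)) :
    MeasurableSet {θ | meshState (_root_.rotated F θ) n = s} := by
  induction n generalizing s with
  | zero => exact MeasurableSet.const (([(1, 0)], [(0, 1), (-1, 0), (0, -1), (1, 0)]) = s)
  | succ n ih =>
    have h : {θ | meshState (_root_.rotated F θ) (n + 1) = s} =
        ⋃ s', {θ | meshState (_root_.rotated F θ) n = s'} ∩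
          {θ | meshStep (_root_.rotated F θ) s' = s} := by
      ext θ
      simp [meshState, Function.iterate_succ_apply']
    rw [h]
    exact MeasurableSet.iUnion fun s' => (ih s').inter (hF.measurableSet_meshStep s' s)

lemma exists_meshStopsWith_rotated (hF : IsAsymNorm F) (θ : ℝ) :
    ∃ L, MeshStopsWith (_root_.rotated F θ) L := by
  obtain ⟨L, hL, -⟩ := exists_meshStopsWith
    ((hF.rotated θ).acuteBeyond (hF.ratioLe.rotated θ) (Nat.lt_floor_add_one _).le)
  exact ⟨L, hL⟩

lemma measurable_meshCard_rotated (hF : IsAsymNorm F) :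
    Measurable fun θ => meshCard (_root_.rotated F θ) := by
  refine measurable_to_countable' fun k => ?_
  have h : (fun θ => meshCard (_root_.rotated F θ)) ⁻¹' {k} =
      ⋃ (L : List (ℤ × ℤ)) (n : ℕ), {θ | meshState (_root_.rotated F θ) n = (L, [])} ∩
        {_θ : ℝ | (fanOf L).ncard = k} := by
    ext θ
    simp only [Set.mem_preimage, Set.mem_singleton_iff, Set.mem_iUnion, Set.mem_inter_iff,
      Set.mem_ofPred_eq]
    constructor
    · intro h
      obtain ⟨L, n, hn⟩ := hF.exists_meshStopsWith_rotated θ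
      exact ⟨L, n, hn, by rw [← h, MeshStopsWith.meshCard_eq ⟨n, hn⟩]⟩
    · rintro ⟨L, n, hn, h⟩
      rw [MeshStopsWith.meshCard_eq ⟨n, hn⟩, h]
  rw [h]
  exact MeasurableSet.iUnion fun L => MeasurableSet.iUnion fun n =>
    (hF.measurableSet_meshState n _).inter (.const _)

lemma meshCard_rotated_le (hF : IsAsymNorm F) (θ : ℝ) : meshCard (_root_.rotated F θ) ≤
    5 + 4 * (obtusePairs (_root_.rotated F θ) ⌊anisotropyRatio F⌋₊).card :=
  meshCard_le ((hF.rotated θ).acuteBeyond (hF.ratioLe.rotated θ) (Nat.lt_floor_add_one _).le)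

lemma intervalIntegrable_meshCard_rotated (hF : IsAsymNorm F) (a b : ℝ) :
    IntervalIntegrable (fun θ => (meshCard (_root_.rotated F θ) : ℝ)) volume a b := by
  rw [intervalIntegrable_iff]
  refine Measure.integrableOn_of_bounded
    (M := (5 + 4 * (directPairs ⌊anisotropyRatio F⌋₊).card : ℕ)) (by simp)
    (measurable_from_top.comp hF.measurable_meshCard_rotated).aestronglyMeasurable
    (Filter.Eventually.of_forall fun θ => ?_)
  rw [Real.norm_natCast]
  refine Nat.cast_le.2 ((hF.meshCard_rotated_le θ).trans ?_)
  have := Finset.card_le_card (fun p hp => (mem_obtusePairs.1 hp).1 :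
    obtusePairs (_root_.rotated F θ) ⌊anisotropyRatio F⌋₊ ⊆ directPairs ⌊anisotropyRatio F⌋₊)
  omega

end IsAsymNorm

/-! ### Averaging over rotations. -/

/-- The indicator function of `tiltSet F s`. -/
noncomputable def tiltInd (F : Plane → ℝ) (s φ : ℝ) : ℝ := (tiltSet F s).indicator (fun _ => 1) φ

lemma tiltInd_of_mem {F : Plane → ℝ} {s φ : ℝ} (h : φ ∈ tiltSet F s) : tiltInd F s φ = 1 :=
  Set.indicator_of_mem h _

lemma tiltInd_nonneg (F : Plane → ℝ) (s φ : ℝ) : 0 ≤ tiltInd F s φ :=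
  Set.indicator_nonneg (fun _ _ => zero_le_one) _

lemma tiltInd_le_one (F : Plane → ℝ) (s φ : ℝ) : tiltInd F s φ ≤ 1 :=
  Set.indicator_le_self' (fun _ _ => zero_le_one) φ

lemma periodic_tiltInd (F : Plane → ℝ) (s : ℝ) :
    Function.Periodic (tiltInd F s) (2 * Real.pi) := fun φ => by
  by_cases h : φ ∈ tiltSet F s
  · rw [tiltInd_of_mem h, tiltInd_of_mem ((mem_tiltSet_add_two_pi F s φ).2 h)]
  · rw [tiltInd, tiltInd, Set.indicator_of_notMem h,
      Set.indicator_of_notMem (mt (mem_tiltSet_add_two_pi F s φ).1 h)]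

namespace IsAsymNorm

open Real

variable {F : Plane → ℝ}

lemma locallyIntegrable_tiltInd (hF : IsAsymNorm F) (s : ℝ) : LocallyIntegrable (tiltInd F s) :=
  (locallyIntegrable_const (1 : ℝ)).indicator (isOpen_tiltSet hF s).measurableSet

lemma intervalIntegrable_tiltInd (hF : IsAsymNorm F) (s a b : ℝ) :
    IntervalIntegrable (tiltInd F s) volume a b :=
  ((hF.locallyIntegrable_tiltInd s).integrableOn_isCompact isCompact_uIcc).intervalIntegrable

/-- Under the integral sign, the sum at `φ` counts bases whose scalar product is a tilt at `φ`. If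
all positive integer tilts there are at most `m`, the counting estimate bounds the part with
positive scalar product by a multiple of `m * (1 + log (K + 2))`, to which the tilt integral
applies. Orthogonal bases, out of reach of the bound for tilts `s ≥ 1`, cost at most `2 * π` each.
-/
lemma sum_integral_tiltInd_le (hF : IsAsymNorm F) {κ : ℝ} (hκ : RatioLe F κ) (h1κ : 1 ≤ κ)
    (K : ℕ) :
    ∑ p ∈ directPairs K, ∫ φ in (0 : ℝ)..(2 * π), tiltInd F (latticeDot p.1 p.2) φ ≤
      2 * π * (directPairs 0).card + 8 * (384 * (1 + log (K + 2)) * log κ) := by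
  classical
  set c : ℝ := 384 * (1 + log (K + 2))
  have hlog : ∀ j : ℕ, 0 ≤ log ((j : ℝ) + 2) := fun j =>
    log_nonneg (by linarith [(Nat.cast_nonneg j : (0 : ℝ) ≤ j)])
  have hc : 0 ≤ c := mul_nonneg (by norm_num) (by linarith [hlog K])
  set P := (directPairs K).filter fun p => 1 ≤ latticeDot p.1 p.2
  have hP : ∑ p ∈ P, ∫ φ in (0 : ℝ)..(2 * π), tiltInd F (latticeDot p.1 p.2) φ ≤
      8 * (c * log κ) := by
    rw [← intervalIntegral.integral_finsetSum fun p _ =>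
      hF.intervalIntegrable_tiltInd _ 0 (2 * π)]
    refine hF.integral_two_pi_le_of_tilt hκ h1κ hc
      (locallyIntegrable_finsetSum P fun p _ => hF.locallyIntegrable_tiltInd _)
      fun φ m hm h => ?_
    have hsum : ∑ p ∈ P, tiltInd F (latticeDot p.1 p.2) φ =
        ((P.filter fun p => φ ∈ tiltSet F (latticeDot p.1 p.2)).card : ℝ) := by
      simp only [tiltInd, Set.indicator_apply]
      rw [Finset.sum_boole]
    have hle : ∀ p ∈ P.filter fun p => φ ∈ tiltSet F (latticeDot p.1 p.2),
        (latticeDot p.1 p.2 : ℝ) ≤ m := fun p hp => by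
      obtain ⟨hp, hφ⟩ := Finset.mem_filter.1 hp
      have h1 := (Finset.mem_filter.1 hp).2
      have e : ((latticeDot p.1 p.2).toNat : ℝ) = latticeDot p.1 p.2 := by
        exact_mod_cast Int.toNat_of_nonneg (by omega : 0 ≤ latticeDot p.1 p.2)
      have := h (latticeDot p.1 p.2).toNat (by omega) (by rwa [e])
      rwa [e] at this
    rw [hsum]
    rcases lt_or_ge m 1 with hm1 | hm1
    · rw [Finset.card_eq_zero.2 (Finset.eq_empty_of_forall_notMem fun p hp => ?_)]
      · simpa using mul_nonneg hc hm
      · have h1 : ((1 : ℤ) : ℝ) ≤ latticeDot p.1 p.2 :=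
          Int.cast_le.2 (Finset.mem_filter.1 (Finset.mem_filter.1 hp).1).2
        have := hle p hp
        push_cast at h1
        linarith
    -- The minimum serves twice: `j ≤ m` bounds the linear factor of the count and `j ≤ K` its
    -- logarithm. As `m ≥ 1`, `2 * j + 1 ≤ 3 * m`, whence `384 = 128 * 3`.
    · set j := min K ⌊m⌋₊
      have hsub : (P.filter fun p => φ ∈ tiltSet F (latticeDot p.1 p.2)) ⊆ directPairs j := by
        intro p hp
        have hK := mem_directPairs.1
          (Finset.mem_filter.1 (Finset.mem_filter.1 hp).1).1
        refine mem_directPairs.2 ⟨hK.1, hK.2.1, ?_⟩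
        have h2 : latticeDot p.1 p.2 ≤ ⌊m⌋ := Int.le_floor.2 (hle p hp)
        rw [← Int.natCast_floor_eq_floor hm] at h2
        simp only [j, Nat.cast_min]
        exact le_min hK.2.2 h2
      have hjm : (j : ℝ) ≤ m := (Nat.cast_le.2 (min_le_right _ _)).trans (Nat.floor_le hm)
      have hjK : (j : ℝ) ≤ K := Nat.cast_le.2 (min_le_left _ _)
      have hl : log ((j : ℝ) + 2) ≤ log (K + 2) := log_le_log (by positivity) (by linarith)
      calc _ ≤ ((directPairs j).card : ℝ) := Nat.cast_le.2 (Finset.card_le_card hsub)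
        _ ≤ 128 * (2 * j + 1) * (1 + log (j + 2)) := card_directPairs_le j
        _ ≤ 128 * (3 * m) * (1 + log (K + 2)) :=
          mul_le_mul (by linarith) (by linarith) (by linarith [hlog j]) (by positivity)
        _ = c * m := by simp only [c]; ring
  have hP0 : ∑ p ∈ (directPairs K).filter (fun p => ¬ 1 ≤ latticeDot p.1 p.2),
      ∫ φ in (0 : ℝ)..(2 * π), tiltInd F (latticeDot p.1 p.2) φ ≤
      2 * π * (directPairs 0).card := by
    have hsub : (directPairs K).filter (fun p => ¬ 1 ≤ latticeDot p.1 p.2) ⊆ directPairs 0 := by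
      intro p hp
      obtain ⟨hp, h1⟩ := Finset.mem_filter.1 hp
      have hK := mem_directPairs.1 hp
      exact mem_directPairs.2 ⟨hK.1, hK.2.1, by push_cast; omega⟩
    calc _ ≤ ∑ p ∈ (directPairs K).filter (fun p => ¬ 1 ≤ latticeDot p.1 p.2), 2 * π := by
          refine Finset.sum_le_sum fun p _ => ?_
          have := intervalIntegral.integral_mono_on (by positivity : (0 : ℝ) ≤ 2 * π)
            (hF.intervalIntegrable_tiltInd (latticeDot p.1 p.2) 0 (2 * π))
            (intervalIntegrable_const (c := (1 : ℝ))) fun φ _ => tiltInd_le_one _ _ _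
          simpa using this
      _ ≤ 2 * π * (directPairs 0).card := by
          rw [Finset.sum_const, nsmul_eq_mul, mul_comm]
          exact mul_le_mul_of_nonneg_left (Nat.cast_le.2 (Finset.card_le_card hsub))
            (by positivity)
  rw [← Finset.sum_filter_add_sum_filter_not (directPairs K)
    fun p => 1 ≤ latticeDot p.1 p.2]
  linarith

lemma card_obtusePairs_rotated_le (hF : IsAsymNorm F) (K : ℕ) (θ : ℝ) :
    ((obtusePairs (_root_.rotated F θ) K).card : ℝ) ≤ ∑ p ∈ directPairs K,
      (tiltInd F (latticeDot p.1 p.2) (polarAngle (latticeVec p.1) - θ) +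
        tiltInd (fun w => F (reflection w)) (latticeDot p.1 p.2)
          (-polarAngle (latticeVec p.2) - -θ)) := by
  have hsub : obtusePairs (_root_.rotated F θ) K ⊆ directPairs K := fun p hp =>
    (mem_obtusePairs.1 hp).1
  refine le_trans ?_ (Finset.sum_le_sum_of_subset_of_nonneg hsub fun p _ _ =>
    add_nonneg (tiltInd_nonneg _ _ _) (tiltInd_nonneg _ _ _))
  rw [Finset.cast_card]
  refine Finset.sum_le_sum fun p hp => ?_
  obtain ⟨hp, hacute⟩ := mem_obtusePairs.1 hp
  rcases (hF.rotated θ).mem_tiltSet_of_not_acute (mem_directPairs.1 hp).1 hacute with h | h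
  · rw [mem_tiltSet_rotated] at h
    rw [tiltInd_of_mem h]
    exact le_add_of_nonneg_right (tiltInd_nonneg _ _ _)
  · have h' : -polarAngle (latticeVec p.2) - -θ ∈
        tiltSet (fun w => F (reflection w)) (latticeDot p.1 p.2) := by
      rw [mem_tiltSet_reflected] at h ⊢
      simp only [_root_.rotated, map_add, map_sub, map_smul, transpose_rotationMatrix_dir,
        transpose_rotationMatrix_dirPerp] at h
      have e : -(-polarAngle (latticeVec p.2) - -θ) = - -polarAngle (latticeVec p.2) - θ := by ring
      rwa [e]
    rw [tiltInd_of_mem h']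
    exact le_add_of_nonneg_left (tiltInd_nonneg _ _ _)

lemma integral_tiltInd_sub_left (F : Plane → ℝ) (s a : ℝ) :
    ∫ θ in (0 : ℝ)..(2 * π), tiltInd F s (a - θ) = ∫ φ in (0 : ℝ)..(2 * π), tiltInd F s φ := by
  rw [intervalIntegral.integral_comp_sub_left]
  have := (periodic_tiltInd F s).intervalIntegral_add_eq (a - 2 * π) 0
  simpa using this

lemma integral_tiltInd_add_left (F : Plane → ℝ) (s a : ℝ) :
    ∫ θ in (0 : ℝ)..(2 * π), tiltInd F s (a - -θ) = ∫ φ in (0 : ℝ)..(2 * π), tiltInd F s φ := by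
  simp only [sub_neg_eq_add]
  rw [intervalIntegral.integral_comp_add_left]
  have := (periodic_tiltInd F s).intervalIntegral_add_eq a 0
  simpa using this

lemma integral_meshCard_rotated_le (hF : IsAsymNorm F) :
    ∫ θ in (0 : ℝ)..(2 * π), (meshCard (_root_.rotated F θ) : ℝ) ≤
      16424 + 24576 * (3 + log (anisotropyRatio F)) * log (anisotropyRatio F) := by
  set κ := anisotropyRatio F
  set K := ⌊κ⌋₊
  have h1κ : 1 ≤ κ := hF.one_le_anisotropyRatio
  have hL : 0 ≤ log κ := log_nonneg h1κ
  set F' : Plane → ℝ := fun w => F (reflection w)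
  have hF' : IsAsymNorm F' := hF.reflected
  have hint1 : ∀ p ∈ directPairs K, IntervalIntegrable (fun θ =>
      tiltInd F (latticeDot p.1 p.2) (polarAngle (latticeVec p.1) - θ)) volume 0 (2 * π) :=
    fun p _ => by
      have := (hF.intervalIntegrable_tiltInd (latticeDot p.1 p.2)
        (polarAngle (latticeVec p.1) - 0) (polarAngle (latticeVec p.1) - 2 * π)).comp_sub_left
        (polarAngle (latticeVec p.1))
      simpa using this
  have hint2 : ∀ p ∈ directPairs K, IntervalIntegrable (fun θ =>
      tiltInd F' (latticeDot p.1 p.2) (-polarAngle (latticeVec p.2) - -θ)) volume 0 (2 * π) :=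
    fun p _ => by
      have := (hF'.intervalIntegrable_tiltInd (latticeDot p.1 p.2)
        (-polarAngle (latticeVec p.2) + 0) (-polarAngle (latticeVec p.2) + 2 * π)).comp_add_left
        (-polarAngle (latticeVec p.2))
      simpa [sub_neg_eq_add] using this
  have hint : IntervalIntegrable (fun θ => ∑ p ∈ directPairs K,
      (tiltInd F (latticeDot p.1 p.2) (polarAngle (latticeVec p.1) - θ) +
        tiltInd F' (latticeDot p.1 p.2) (-polarAngle (latticeVec p.2) - -θ))) volume
        0 (2 * π) := by
    simpa only [Finset.sum_fn] using
      IntervalIntegrable.sum _ fun p hp => (hint1 p hp).add (hint2 p hp)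
  have hmono := intervalIntegral.integral_mono_on (by positivity : (0 : ℝ) ≤ 2 * π)
    (hF.intervalIntegrable_meshCard_rotated 0 (2 * π))
    ((intervalIntegrable_const (c := (5 : ℝ))).add (hint.const_mul 4)) fun θ _ =>
      (Nat.cast_le (α := ℝ).2 (hF.meshCard_rotated_le θ)).trans (by
        push_cast
        linarith [hF.card_obtusePairs_rotated_le K θ])
  rw [intervalIntegral.integral_add intervalIntegrable_const (hint.const_mul 4),
    intervalIntegral.integral_const, intervalIntegral.integral_const_mul,
    intervalIntegral.integral_finsetSum fun p hp => (hint1 p hp).add (hint2 p hp),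
    Finset.sum_congr rfl fun p hp => intervalIntegral.integral_add (hint1 p hp) (hint2 p hp),
    Finset.sum_add_distrib] at hmono
  simp only [integral_tiltInd_sub_left, integral_tiltInd_add_left, smul_eq_mul] at hmono
  have hs1 := hF.sum_integral_tiltInd_le hF.ratioLe h1κ K
  have hs2 := hF'.sum_integral_tiltInd_le hF.ratioLe.reflected h1κ K
  have hKκ : (K : ℝ) ≤ κ := Nat.floor_le (by linarith)
  have hlog : log ((K : ℝ) + 2) ≤ 2 + log κ := by
    calc log ((K : ℝ) + 2) ≤ log (3 * κ) := log_le_log (by positivity) (by linarith)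
      _ = log 3 + log κ := log_mul (by norm_num) (by linarith)
      _ ≤ 2 + log κ := by linarith [log_le_sub_one_of_pos (by norm_num : (0 : ℝ) < 3)]
  have hmul := mul_le_mul_of_nonneg_right hlog hL
  have hcard := card_directPairs_le 0
  have hlog2 : log ((0 : ℕ) + 2 : ℝ) ≤ 1 := by
    have := log_le_sub_one_of_pos (by norm_num : (0 : ℝ) < 2)
    norm_num at this ⊢
    exact this
  have hcard0 : ((directPairs 0).card : ℝ) ≤ 256 := by
    push_cast at hcard hlog2
    linarith
  have hpi := pi_le_four
  have hpc : π * (directPairs 0).card ≤ 4 * 256 :=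
    mul_le_mul hpi hcard0 (Nat.cast_nonneg _) (by norm_num)
  -- The constant is `5 * 2π ≤ 40` plus `4 * 2 * 2π * 256 ≤ 16384`, the factor `2` counting `F` and
  -- its reflection; the other coefficient is `4 * 2 * 8 * 384 = 24576`.
  linarith

end IsAsymNorm

/-- Average cardinality of the mesh over all rotations of an asymmetric norm. The first two clauses
say that the quantities in the estimates are well defined: the mesh construction stops for every
asymmetric norm, and the cardinality of the mesh is an integrable function of the angle. -/
theorem mainTheorem1 :
    ∃ C : ℝ, ∀ F : Plane → ℝ, IsAsymNorm F →
      (∀ θ : ℝ, ∃ L, MeshStopsWith (rotated F θ) L) ∧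
      IntervalIntegrable (fun θ : ℝ => (meshCard (rotated F θ) : ℝ)) volume 0 (2 * Real.pi) ∧
      (∫ θ in (0 : ℝ)..(2 * Real.pi), (meshCard (rotated F θ) : ℝ)) ≤
        C * (1 + Real.log (anisotropyRatio F) ^ 3) ∧
      ((∀ u : Plane, F (-u) = F u) →
        (∫ θ in (0 : ℝ)..(2 * Real.pi), (meshCard (rotated F θ) : ℝ)) ≤
          C * (1 + Real.log (anisotropyRatio F) ^ 2)) := by
  refine ⟨200000, fun F hF => ⟨hF.exists_meshStopsWith_rotated,
    hF.intervalIntegrable_meshCard_rotated _ _, ?_, fun _ => ?_⟩⟩ <;>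
  · have hL : 0 ≤ Real.log (anisotropyRatio F) := Real.log_nonneg hF.one_le_anisotropyRatio
    have h := hF.integral_meshCard_rotated_le
    set L := Real.log (anisotropyRatio F)
    nlinarith [mul_nonneg hL (sq_nonneg (L - 1)), sq_nonneg (L - 1), pow_nonneg hL 3]
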